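/- Let $n\ge 1$, let $B_R(p)$ denote the open ball of radius $R$ and centre $p$ in $\mathbb{R}^n$, and let $B_1=B_1(c)$ be a unit ball. For real functions $b_0,b_1\in C^{1,1}(B_1)$ (that is, differentiable with $\|b_j\|_{C^2(B_1)}:=\sup_{B_1}|b_j|+\sup_{B_1}|\nabla b_j|+\mathrm{Lip}_{B_1}(\nabla b_j)<\infty$) let $$b_{\mathrm{env}}:=\sup\{f : f \text{ is subharmonic on } B_1,\ f\le\min\{b_0,b_1\} \text{ on } B_1\}$$ be the subharmonic envelope, and let $\Lambda:=\{x\in B_1 : b_{\mathrm{env}}(x)=\min\{b_0,b_1\}(x)\}$ be the contact set. There is a constant $C=C(n,\|b_0\|_{C^2(B_1)},\|b_1\|_{C^2(B_1)})$, depending only on $n$ and on the two norms, such that the following holds. If $x_0\in\Lambda\cap B_{1/4}(c)$ and $\min\{b_0,b_1\}(x_0)=b_i(x_0)$ with $i\in\{0,1\}$, then $$|b_{\mathrm{env}}(x)-b_i(x_0)-\langle\nabla b_i(x_0),x-x_0\rangle|\le C\,|x-x_0|^2\qquad\text{for all } x\in B_{1/8}(x_0).$$ -/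

import Mathlib

open Set Metric InnerProductSpace
open scoped ENNReal Gradient

/-- `u : U → [-∞, ∞)` is subharmonic on the open set `U`: it is upper semicontinuous on `U`, never
`+∞`, and for every closed ball `closedBall y r ⊆ U` and every function `h` that is continuous on
the closed ball and harmonic in the open ball, `u ≤ h` on the sphere implies `u ≤ h` in the ball.
(The function `-∞` is admitted. Values of `u` outside `U` play no role.) -/
structure IsSubharmonicOn {n : ℕ} (u : EuclideanSpace ℝ (Fin n) → EReal)
    (U : Set (EuclideanSpace ℝ (Fin n))) : Prop where
  lt_top : ∀ x ∈ U, u x < ⊤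
  upperSemicontinuousOn : UpperSemicontinuousOn u U
  le_harmonic : ∀ (y : EuclideanSpace ℝ (Fin n)) (r : ℝ), 0 < r → closedBall y r ⊆ U →
    ∀ h : EuclideanSpace ℝ (Fin n) → ℝ, ContinuousOn h (closedBall y r) →
      HarmonicOnNhd h (ball y r) →
      (∀ z ∈ sphere y r, u z ≤ (h z : EReal)) → ∀ z ∈ ball y r, u z ≤ (h z : EReal)

/-- The upper envelope `sup {f ∈ SH(U) : f ≤ φ on U}` of the subharmonic functions on `U` that lie
below the obstacle `φ`, with values in `[-∞, ∞]`. -/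
noncomputable def subharmonicEnvelope {n : ℕ} (U : Set (EuclideanSpace ℝ (Fin n)))
    (φ : EuclideanSpace ℝ (Fin n) → ℝ) (x : EuclideanSpace ℝ (Fin n)) : EReal :=
  sSup {t : EReal | ∃ f : EuclideanSpace ℝ (Fin n) → EReal,
    IsSubharmonicOn f U ∧ (∀ z ∈ U, f z ≤ (φ z : EReal)) ∧ t = f x}

/-- The contact set: the points of `U` where the envelope equals the obstacle. -/
def contactSet {n : ℕ} (U : Set (EuclideanSpace ℝ (Fin n)))
    (φ : EuclideanSpace ℝ (Fin n) → ℝ) : Set (EuclideanSpace ℝ (Fin n)) :=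
  {x | x ∈ U ∧ subharmonicEnvelope U φ x = (φ x : EReal)}

/-- The `C²` norm on an open set `U` in the `C^{1,1}` sense, with values in `[0, ∞]`: the sum of
`sup |f|`, `sup |∇f|` and the best Lipschitz constant of `∇f` (on a ball, the latter is the
essential supremum of the operator norm of the Hessian). The quotient is `0` for `x = y`. -/
noncomputable def c2Norm {n : ℕ} (U : Set (EuclideanSpace ℝ (Fin n)))
    (f : EuclideanSpace ℝ (Fin n) → ℝ) : ℝ≥0∞ :=
  (⨆ x ∈ U, ‖f x‖ₑ) + (⨆ x ∈ U, ‖∇ f x‖ₑ) +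
    ⨆ x ∈ U, ⨆ y ∈ U, ‖∇ f x - ∇ f y‖ₑ / edist x y

/-- `f ∈ C^{1,1}(U)`: `f` is differentiable on the open set `U` and has finite `C²` norm there. -/
def MemC11 {n : ℕ} (U : Set (EuclideanSpace ℝ (Fin n)))
    (f : EuclideanSpace ℝ (Fin n) → ℝ) : Prop :=
  DifferentiableOn ℝ f U ∧ c2Norm U f < ⊤

/-!
Write `φ` for the obstacle `min b₀ b₁`. It is Lipschitz and semiconcave, so the paraboloid with
gradient `∇ bᵢ x₀` touching it from above at `x₀` gives the upper bound. For the lower bound at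
distance `r` from the contact point, take a subharmonic competitor below `φ` that is `r²`-close to
`φ x₀` at `x₀`. A dilation followed by a sup-convolution makes it continuous, at the cost of moving
`x₀` by at most `r²` to a point `p`. Let `H` be a harmonic function close to it on the sphere of
radius `2 r` about `p`: a harmonic polynomial will do, because polynomial boundary values on a
sphere extend to harmonic polynomials and are dense in the continuous ones. Since `φ` is
semiconcave, a sufficiently convex paraboloid vanishing on the sphere can be added to `H` without
crossing `φ`, so the maximum of the result and the competitor is again a competitor, and the
envelope is at least `H - O(r²)`. Finally the touching paraboloid of `φ` minus `H` is, up to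
`O(r²)`, a positive harmonic function of size `O(r²)` at `p`, hence of size `O(r²)` near `p` by
Harnack's inequality.
-/

open scoped Laplacian

section Laplacian

variable {E : Type*} [NormedAddCommGroup E] [InnerProductSpace ℝ E] {f : E → ℝ} {x : E}

theorem fderiv_comp_smul_add {F : Type*} [NormedAddCommGroup F] [NormedSpace ℝ F] (f : E → F)
    (a : ℝ) (v x : E) :
    fderiv ℝ (fun y => f (a • y + v)) x = a • fderiv ℝ f (a • x + v) := by
  rw [fderiv_comp_smul (f := fun z => f (z + v)), fderiv_comp_add_right]

theorem deriv_deriv_comp_line {p e : E} (hf : ContDiffAt ℝ 2 f p) :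
    deriv (deriv fun t : ℝ => f (p + t • e)) 0 = fderiv ℝ (fderiv ℝ f) p e e := by
  have hline (t : ℝ) : HasDerivAt (fun t : ℝ => p + t • e) e t := by
    simpa only [id_eq, one_smul] using ((hasDerivAt_id t).smul_const e).const_add p
  have hlim : Filter.Tendsto (fun t : ℝ => p + t • e) (nhds 0) (nhds p) :=
    Continuous.tendsto' (by fun_prop) _ _ (by simp)
  have hfirst : deriv (fun t : ℝ => f (p + t • e))
      =ᶠ[nhds 0] fun t => fderiv ℝ f (p + t • e) e := by
    filter_upwards [hlim.eventually (hf.eventually (by simp))] with t ht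
    exact ((ht.differentiableAt (by simp)).hasFDerivAt.comp_hasDerivAt t (hline t)).deriv
  have hsecond : HasFDerivAt (fderiv ℝ f) (fderiv ℝ (fderiv ℝ f) p) (p + (0 : ℝ) • e) := by
    rw [zero_smul, add_zero]
    exact ((hf.fderiv_right (m := 1) (by norm_num)).differentiableAt (by simp)).hasFDerivAt
  have hderiv : HasDerivAt (fun t : ℝ => fderiv ℝ f (p + t • e))
      (fderiv ℝ (fderiv ℝ f) p e) 0 := hsecond.comp_hasDerivAt 0 (hline 0)
  rw [hfirst.deriv_eq]
  exact ((ContinuousLinearMap.apply ℝ ℝ e).hasFDerivAt.comp_hasDerivAt 0 hderiv).deriv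

theorem contDiffAt_add_mul_norm_sub_sq (hf : ContDiffAt ℝ 2 f x) (a k : ℝ) (p : E) :
    ContDiffAt ℝ 2 (fun y => f y + a * (‖y - p‖ ^ 2 - k)) x :=
  hf.add (contDiffAt_const.mul
    ((((contDiff_id.sub contDiff_const).norm_sq ℝ).contDiffAt).sub contDiffAt_const))

variable [FiniteDimensional ℝ E]

theorem laplacian_eq_sum_fderiv {ι : Type*} [Fintype ι] (f : E → ℝ) (b : OrthonormalBasis ι ℝ E)
    (x : E) : (Δ f) x = ∑ i, fderiv ℝ (fderiv ℝ f) x (b i) (b i) := by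
  simp [laplacian_eq_iteratedFDeriv_orthonormalBasis f b, iteratedFDeriv_two_apply]

theorem laplacian_comp_smul_add (f : E → ℝ) (a : ℝ) (v x : E) :
    (Δ (fun y => f (a • y + v))) x = a ^ 2 * (Δ f) (a • x + v) := by
  have hfderiv : fderiv ℝ (fderiv ℝ fun y => f (a • y + v)) x
      = a • a • fderiv ℝ (fderiv ℝ f) (a • x + v) := by
    rw [funext (fderiv_comp_smul_add f a v), ← fderiv_comp_smul_add]
    exact congrFun (fderiv_const_smul_field (𝕜 := ℝ) a
      (f := fun y => fderiv ℝ f (a • y + v))) x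
  simp [laplacian_eq_sum_fderiv _ (stdOrthonormalBasis ℝ E), hfderiv, Finset.mul_sum, pow_two,
    mul_assoc]

theorem laplacian_norm_sub_sq (p x : E) :
    (Δ (fun y => ‖y - p‖ ^ 2)) x = 2 * (Module.finrank ℝ E : ℝ) := by
  have hfirst : fderiv ℝ (fun y : E => ‖y - p‖ ^ 2) = fun y => (2 : ℝ) • innerSL ℝ (y - p) := by
    funext y
    refine HasFDerivAt.fderiv ?_
    simpa [two_smul] using ((hasFDerivAt_id y).sub_const p).norm_sq
  have hsecond : HasFDerivAt (fun y : E => (2 : ℝ) • innerSL ℝ (y - p)) ((2 : ℝ) • innerSL ℝ) x :=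
    (((innerSL ℝ).hasFDerivAt (x := x - p)).comp x ((hasFDerivAt_id x).sub_const p)).const_smul
      (2 : ℝ)
  have hdiag (v : E) : ((2 : ℝ) • innerSL ℝ) v v = 2 * ‖v‖ ^ 2 := by
    rw [← real_inner_self_eq_norm_sq]
    rfl
  rw [laplacian_eq_sum_fderiv _ (stdOrthonormalBasis ℝ E), hfirst, hsecond.fderiv]
  simp only [hdiag]
  simp [mul_comm]

theorem harmonicAt_continuousLinearMap (l : E →L[ℝ] ℝ) (x : E) : HarmonicAt l x := by
  have hfderiv : fderiv ℝ l = fun _ => l := funext fun _ => l.fderiv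
  refine ⟨l.contDiff.contDiffAt, .of_forall fun y => ?_⟩
  simp [laplacian_eq_sum_fderiv _ (stdOrthonormalBasis ℝ E), hfderiv]

theorem harmonicAt_comp_smul_add {a : ℝ} {v : E} (hf : HarmonicAt f (a • x + v)) :
    HarmonicAt (fun y => f (a • y + v)) x := by
  have hcont : Continuous fun y : E => a • y + v := by fun_prop
  refine ⟨hf.1.comp x ((contDiff_const.smul contDiff_id).add contDiff_const).contDiffAt, ?_⟩
  filter_upwards [hcont.continuousAt.eventually hf.2] with y hy
  simp only [laplacian_comp_smul_add, hy, Pi.zero_apply, mul_zero]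

theorem laplacian_add_mul_norm_sub_sq (hf : ContDiffAt ℝ 2 f x) (a k : ℝ) (p : E) :
    (Δ (fun y => f y + a * (‖y - p‖ ^ 2 - k))) x
      = (Δ f) x + a * (2 * Module.finrank ℝ E) := by
  have hq : ContDiffAt ℝ 2 (fun y : E => ‖y - p‖ ^ 2) x :=
    ((contDiff_id.sub contDiff_const).norm_sq ℝ).contDiffAt
  have hqk : ContDiffAt ℝ 2 ((fun y : E => ‖y - p‖ ^ 2) - fun _ => k) x := hq.sub contDiffAt_const
  have haqk : ContDiffAt ℝ 2 (a • ((fun y : E => ‖y - p‖ ^ 2) - fun _ => k)) x :=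
    contDiffAt_const.smul hqk
  have hsum : (fun y => f y + a * (‖y - p‖ ^ 2 - k))
      = f + a • ((fun y => ‖y - p‖ ^ 2) - fun _ => k) := rfl
  rw [hsum, hf.laplacian_add haqk, laplacian_smul _ hqk, hq.laplacian_sub contDiffAt_const,
    laplacian_norm_sub_sq]
  simp

end Laplacian

section MaximumPrinciple

variable {E : Type*} [NormedAddCommGroup E] [InnerProductSpace ℝ E] [FiniteDimensional ℝ E]
  {f : E → ℝ}

theorem not_isLocalMax_of_deriv_deriv_pos {g : ℝ → ℝ} {t : ℝ} (hg : ContinuousAt g t)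
    (hpos : 0 < deriv (deriv g) t) : ¬ IsLocalMax g t := by
  intro hmax
  have hmin : IsLocalMin g t := isLocalMin_of_deriv_deriv_pos hpos hmax.deriv_eq_zero hg
  have hconst : g =ᶠ[nhds t] fun _ => g t := by
    filter_upwards [hmax, hmin] with s h₁ h₂ using le_antisymm h₁ h₂
  have := hconst.deriv.deriv_eq
  simp only [deriv_const', deriv_const] at this
  exact hpos.ne' this

theorem not_isLocalMax_of_laplacian_pos {p : E} (hf : ContDiffAt ℝ 2 f p) (hpos : 0 < (Δ f) p) :
    ¬ IsLocalMax f p := by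
  intro hmax
  rw [laplacian_eq_sum_fderiv f (stdOrthonormalBasis ℝ E)] at hpos
  obtain ⟨i, -, hi⟩ := Finset.exists_lt_of_sum_lt (f := fun _ => (0 : ℝ)) (by simpa using hpos)
  set e := stdOrthonormalBasis ℝ E i
  have hline : Filter.Tendsto (fun t : ℝ => p + t • e) (nhds 0) (nhds p) :=
    Continuous.tendsto' (by fun_prop) _ _ (by simp)
  refine not_isLocalMax_of_deriv_deriv_pos (g := fun t : ℝ => f (p + t • e)) (t := 0) ?_
    (by rwa [deriv_deriv_comp_line hf]) ?_
  · simpa [ContinuousAt, Function.comp_def] using hf.continuousAt.tendsto.comp hline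
  · simpa [IsLocalMax, IsMaxFilter] using hline.eventually hmax

theorem le_of_laplacian_pos {K : Set E} {m : ℝ} (hK : IsCompact K) (hc : ContinuousOn f K)
    (h : ∀ x ∈ K, m < f x → K ∈ nhds x ∧ ContDiffAt ℝ 2 f x ∧ 0 < (Δ f) x) :
    ∀ x ∈ K, f x ≤ m := by
  intro x hx
  obtain ⟨p, hp, hmax⟩ := hK.exists_isMaxOn ⟨x, hx⟩ hc
  by_contra! hlt
  obtain ⟨hnhds, hdiff, hpos⟩ := h p hp (hlt.trans_le (hmax hx))
  exact not_isLocalMax_of_laplacian_pos hdiff hpos (hmax.isLocalMax hnhds)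

variable [Nontrivial E] {y : E} {r m : ℝ}

theorem le_of_laplacian_nonneg (hc : ContinuousOn f (closedBall y r))
    (h : ∀ x ∈ ball y r, ContDiffAt ℝ 2 f x ∧ 0 ≤ (Δ f) x) (hs : ∀ x ∈ sphere y r, f x ≤ m) :
    ∀ x ∈ closedBall y r, f x ≤ m := by
  have hdim : (0 : ℝ) < Module.finrank ℝ E := by exact_mod_cast Module.finrank_pos
  have hperturbed (ε : ℝ) (hε : 0 < ε) :
      ∀ x ∈ closedBall y r, f x + ε * (‖x - y‖ ^ 2 - r ^ 2) ≤ m := by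
    refine le_of_laplacian_pos (isCompact_closedBall y r) (hc.add (by fun_prop))
      fun x hx hlt => ?_
    have hxb : x ∈ ball y r := by
      refine (mem_closedBall.mp hx).lt_of_ne fun hxs => ?_
      simp only [← dist_eq_norm, hxs, sub_self, mul_zero, add_zero] at hlt
      exact hlt.not_ge (hs x hxs)
    obtain ⟨hdiff, hlap⟩ := h x hxb
    refine ⟨Filter.mem_of_superset (isOpen_ball.mem_nhds hxb) ball_subset_closedBall,
      contDiffAt_add_mul_norm_sub_sq hdiff _ _ _, ?_⟩
    rw [laplacian_add_mul_norm_sub_sq hdiff]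
    positivity
  intro x hx
  have hlim : Filter.Tendsto (fun ε : ℝ => f x + ε * (‖x - y‖ ^ 2 - r ^ 2))
      (nhdsWithin 0 (Ioi 0)) (nhds (f x)) :=
    tendsto_nhdsWithin_of_tendsto_nhds (Continuous.tendsto' (by fun_prop) _ _ (by simp))
  refine le_of_tendsto hlim ?_
  filter_upwards [self_mem_nhdsWithin] with ε hε using hperturbed ε hε x hx

theorem le_of_harmonicOnNhd (hc : ContinuousOn f (closedBall y r))
    (h : HarmonicOnNhd f (ball y r)) (hs : ∀ x ∈ sphere y r, f x ≤ m) :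
    ∀ x ∈ closedBall y r, f x ≤ m :=
  le_of_laplacian_nonneg hc (fun x hx => ⟨(h x hx).1, (h x hx).2.self_of_nhds.ge⟩) hs

theorem le_of_harmonicOnNhd_of_le (hc : ContinuousOn f (closedBall y r))
    (h : HarmonicOnNhd f (ball y r)) (hs : ∀ x ∈ sphere y r, m ≤ f x) :
    ∀ x ∈ closedBall y r, m ≤ f x := fun x hx =>
  neg_le_neg_iff.mp (le_of_harmonicOnNhd hc.neg h.neg (fun z hz => neg_le_neg (hs z hz)) x hx)

end MaximumPrinciple

section HarmonicPolynomials

open MvPolynomial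

variable {ι : Type*}

/-- The polynomial function on Euclidean space defined by a polynomial in the coordinates. -/
noncomputable def polynomialMap : MvPolynomial ι ℝ →ₐ[ℝ] C(EuclideanSpace ℝ ι, ℝ) :=
  aeval fun i => ⟨fun x => x i, by fun_prop⟩

theorem polynomialMap_apply (P : MvPolynomial ι ℝ) (x : EuclideanSpace ℝ ι) :
    polynomialMap P x = eval x.ofLp P := by
  induction P using MvPolynomial.induction_on with
  | C a => simp [polynomialMap]
  | add p q hp hq => simp [hp, hq]
  | mul_X p i hp =>
    rw [map_mul, ContinuousMap.mul_apply, hp]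
    simp [polynomialMap]

theorem separatesPoints_range_polynomialMap :
    (polynomialMap (ι := ι)).range.SeparatesPoints := by
  intro x y hxy
  obtain ⟨i, hi⟩ : ∃ i, x i ≠ y i := by
    by_contra! h
    exact hxy (PiLp.ext h)
  exact ⟨_, ⟨_, ⟨X i, rfl⟩, rfl⟩, by simpa [polynomialMap_apply] using hi⟩

variable [Fintype ι]

theorem contDiff_polynomialMap (P : MvPolynomial ι ℝ) {k : WithTop ℕ∞} :
    ContDiff ℝ k (polynomialMap P) := by
  rw [funext (polynomialMap_apply P)]
  exact (AnalyticOnNhd.eval_mvPolynomial P).contDiff.comp (by fun_prop)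

theorem fderiv_polynomialMap (P : MvPolynomial ι ℝ) (x : EuclideanSpace ℝ ι) (i : ι) :
    fderiv ℝ (polynomialMap P) x (EuclideanSpace.basisFun ι ℝ i)
      = polynomialMap (pderiv i P) x := by
  classical
  have hdiff (Q : MvPolynomial ι ℝ) : DifferentiableAt ℝ (polynomialMap Q) x :=
    (contDiff_polynomialMap Q (k := 1)).differentiable (by simp) x
  induction P using MvPolynomial.induction_on with
  | C a =>
    have hconst : ⇑(polynomialMap (C a : MvPolynomial ι ℝ)) = fun _ => a :=
      funext fun x => by rw [polynomialMap_apply, eval_C]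
    rw [hconst, fderiv_const_apply]
    simp
  | add p q hp hq =>
    simp only [map_add, ContinuousMap.coe_add, ContinuousMap.add_apply]
    rw [fderiv_add (hdiff p) (hdiff q), add_apply, hp, hq]
  | mul_X p j hp =>
    have hX : ⇑(polynomialMap (X j : MvPolynomial ι ℝ)) = EuclideanSpace.proj (𝕜 := ℝ) j :=
      funext fun x => by simp [polynomialMap_apply]
    simp only [map_mul, ContinuousMap.coe_mul, pderiv_mul, map_add, ContinuousMap.add_apply,
      ContinuousMap.mul_apply]
    rw [fderiv_mul (hdiff p) (hdiff _), hX, ContinuousLinearMap.fderiv]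
    simp only [add_apply, smul_apply, hp, pderiv_X]
    by_cases h : j = i
    · subst h
      simp [polynomialMap_apply, mul_comm, add_comm]
    · simp [h, mul_comm]

/-- The Laplacian `∑ ∂ᵢ²` on polynomials. -/
noncomputable def polynomialLaplacian : MvPolynomial ι ℝ →ₗ[ℝ] MvPolynomial ι ℝ :=
  ∑ i, (pderiv i).toLinearMap ∘ₗ (pderiv i).toLinearMap

theorem laplacian_polynomialMap (P : MvPolynomial ι ℝ) (x : EuclideanSpace ℝ ι) :
    (Δ ⇑(polynomialMap P)) x = polynomialMap (polynomialLaplacian P) x := by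
  rw [laplacian_eq_sum_fderiv _ (EuclideanSpace.basisFun ι ℝ), polynomialLaplacian]
  simp only [LinearMap.sum_apply, map_sum, LinearMap.comp_apply, Derivation.coeFn_coe,
    ContinuousMap.sum_apply]
  refine Finset.sum_congr rfl fun i _ => ?_
  have hdiff : DifferentiableAt ℝ (fderiv ℝ (polynomialMap P)) x :=
    ((contDiff_polynomialMap P (k := 2)).fderiv_right (m := 1) (by norm_num)).differentiable
      (by simp) x
  rw [← fderiv_polynomialMap, ← funext fun y => fderiv_polynomialMap P y i,
    fderiv_clm_apply hdiff (differentiableAt_const _)]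
  simp

theorem totalDegree_polynomialLaplacian_le {P : MvPolynomial ι ℝ} {k : ℕ}
    (h : P.totalDegree ≤ k + 2) : (polynomialLaplacian P).totalDegree ≤ k := by
  rw [polynomialLaplacian, LinearMap.sum_apply]
  refine totalDegree_finsetSum_le fun i _ => Finset.sup_le fun m hm => ?_
  rw [mem_support_iff] at hm
  simp only [LinearMap.comp_apply, Derivation.coeFn_coe, coeff_pderiv] at hm
  have hdeg := le_totalDegree
    (mem_support_iff.mpr (left_ne_zero_of_mul (left_ne_zero_of_mul hm)))
  rw [Finsupp.sum_add_index' (by simp) (by simp), Finsupp.sum_add_index' (by simp) (by simp)]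
    at hdeg
  simp only [Finsupp.sum_single_index] at hdeg
  omega

theorem harmonicOnNhd_polynomialMap {P : MvPolynomial ι ℝ} (hP : polynomialLaplacian P = 0)
    (s : Set (EuclideanSpace ℝ ι)) : HarmonicOnNhd (polynomialMap P) s := fun _ _ =>
  ⟨(contDiff_polynomialMap P).contDiffAt, .of_forall fun y => by simp [laplacian_polynomialMap, hP]⟩

/-- The defining polynomial `R² - |X - p|²` of the sphere of radius `R` and centre `p`. -/
noncomputable def spherePolynomial (p : EuclideanSpace ℝ ι) (R : ℝ) : MvPolynomial ι ℝ :=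
  C (R ^ 2) - ∑ i, (X i - C (p i)) ^ 2

theorem polynomialMap_spherePolynomial (p x : EuclideanSpace ℝ ι) (R : ℝ) :
    polynomialMap (spherePolynomial p R) x = R ^ 2 - ‖x - p‖ ^ 2 := by
  simp [polynomialMap_apply, spherePolynomial, EuclideanSpace.norm_sq_eq]

theorem totalDegree_spherePolynomial_le (p : EuclideanSpace ℝ ι) (R : ℝ) :
    (spherePolynomial p R).totalDegree ≤ 2 := by
  refine (totalDegree_sub _ _).trans (max_le ((totalDegree_C _).trans_le (Nat.zero_le _)) ?_)
  refine totalDegree_finsetSum_le fun i _ => (totalDegree_pow _ _).trans ?_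
  have hlin : (X i - C (p i) : MvPolynomial ι ℝ).totalDegree ≤ 1 :=
    (totalDegree_sub _ _).trans (max_le (by simp) (by simp))
  omega

variable {p : EuclideanSpace ℝ ι} {R : ℝ}

theorem polynomialMap_spherePolynomial_mul_eq_zero (Q : MvPolynomial ι ℝ)
    {x : EuclideanSpace ℝ ι} (hx : x ∈ sphere p R) :
    polynomialMap (spherePolynomial p R * Q) x = 0 := by
  rw [map_mul, ContinuousMap.mul_apply, polynomialMap_spherePolynomial, ← dist_eq_norm,
    mem_sphere.mp hx, sub_self, zero_mul]

theorem eq_zero_of_polynomialMap_eqOn_zero (hR : 0 < R) {Q : MvPolynomial ι ℝ}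
    (h : ∀ x ∈ ball p R, polynomialMap Q x = 0) : Q = 0 := by
  have hcont : Continuous (WithLp.toLp 2 : (ι → ℝ) → EuclideanSpace ℝ ι) := by fun_prop
  obtain ⟨δ, hδ, hsub⟩ := Metric.isOpen_iff.mp (isOpen_ball.preimage hcont) (p : ι → ℝ)
    (mem_ball_self hR : p ∈ ball p R)
  refine MvPolynomial.funext_set (fun i => ball (p i) δ)
    (fun i => by rw [Real.ball_eq_Ioo]; exact Ioo_infinite (by linarith)) fun x hx => ?_
  rw [← ball_pi _ hδ] at hx
  simpa [polynomialMap_apply] using h _ (hsub hx)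

variable [Nonempty ι]

theorem eq_zero_of_polynomialLaplacian_spherePolynomial_mul (hR : 0 < R) {Q : MvPolynomial ι ℝ}
    (h : polynomialLaplacian (spherePolynomial p R * Q) = 0) : Q = 0 := by
  refine eq_zero_of_polynomialMap_eqOn_zero (p := p) hR fun x hx => ?_
  have hharm := harmonicOnNhd_polynomialMap h (ball p R)
  have hcont := (polynomialMap (spherePolynomial p R * Q)).continuous.continuousOn
    (s := closedBall p R)
  have hzero (z) (hz : z ∈ sphere p R) := polynomialMap_spherePolynomial_mul_eq_zero Q hz
  have hprod : polynomialMap (spherePolynomial p R * Q) x = 0 :=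
    le_antisymm
      (le_of_harmonicOnNhd hcont hharm (fun z hz => (hzero z hz).le) x
        (ball_subset_closedBall hx))
      (le_of_harmonicOnNhd_of_le hcont hharm (fun z hz => (hzero z hz).ge) x
        (ball_subset_closedBall hx))
  rw [map_mul, ContinuousMap.mul_apply, polynomialMap_spherePolynomial] at hprod
  refine (mul_eq_zero.mp hprod).resolve_left (sub_pos.mpr ?_).ne'
  exact pow_lt_pow_left₀ (by rwa [← mem_ball_iff_norm]) (norm_nonneg _) two_ne_zero

theorem exists_polynomialLaplacian_spherePolynomial_mul_eq (p : EuclideanSpace ℝ ι) (hR : 0 < R)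
    (P : MvPolynomial ι ℝ) :
    ∃ Q, polynomialLaplacian (spherePolynomial p R * Q) = polynomialLaplacian P := by
  set k := P.totalDegree
  have hdeg : ∀ Q ∈ restrictTotalDegree ι ℝ k,
      polynomialLaplacian (spherePolynomial p R * Q) ∈ restrictTotalDegree ι ℝ k := by
    intro Q hQ
    rw [mem_restrictTotalDegree] at hQ ⊢
    refine totalDegree_polynomialLaplacian_le ((totalDegree_mul _ _).trans ?_)
    have := totalDegree_spherePolynomial_le p R
    omega
  set T : restrictTotalDegree ι ℝ k →ₗ[ℝ] restrictTotalDegree ι ℝ k :=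
    (polynomialLaplacian ∘ₗ LinearMap.mulLeft ℝ (spherePolynomial p R)).restrict hdeg
  have hinj : Function.Injective T :=
    LinearMap.ker_eq_bot.mp <| LinearMap.ker_eq_bot'.mpr fun Q hQ => Subtype.ext <|
      eq_zero_of_polynomialLaplacian_spherePolynomial_mul hR (congrArg Subtype.val hQ)
  have hP : polynomialLaplacian P ∈ restrictTotalDegree ι ℝ k :=
    (mem_restrictTotalDegree _ _ _).mpr (totalDegree_polynomialLaplacian_le (Nat.le_add_right _ _))
  obtain ⟨Q, hQ⟩ := LinearMap.injective_iff_surjective.mp hinj ⟨_, hP⟩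
  exact ⟨Q, congrArg Subtype.val hQ⟩

theorem exists_harmonic_polynomial_eq_on_sphere (p : EuclideanSpace ℝ ι) (hR : 0 < R)
    (P : MvPolynomial ι ℝ) :
    ∃ H : MvPolynomial ι ℝ, polynomialLaplacian H = 0 ∧
      ∀ x ∈ sphere p R, polynomialMap H x = polynomialMap P x := by
  obtain ⟨Q, hQ⟩ := exists_polynomialLaplacian_spherePolynomial_mul_eq p hR P
  refine ⟨P - spherePolynomial p R * Q, by rw [map_sub, hQ, sub_self], fun x hx => ?_⟩
  rw [map_sub, ContinuousMap.sub_apply, polynomialMap_spherePolynomial_mul_eq_zero Q hx, sub_zero]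

theorem exists_harmonic_near_on_sphere (p : EuclideanSpace ℝ ι) (hR : 0 < R)
    {F : EuclideanSpace ℝ ι → ℝ} (hF : Continuous F) {ε : ℝ} (hε : 0 < ε) :
    ∃ H : EuclideanSpace ℝ ι → ℝ, HarmonicOnNhd H univ ∧ ∀ x ∈ sphere p R, |H x - F x| < ε := by
  obtain ⟨-, ⟨P, rfl⟩, hP⟩ :=
    ContinuousMap.exists_mem_subalgebra_near_continuous_of_isCompact_of_separatesPoints
      separatesPoints_range_polynomialMap ⟨F, hF⟩ (isCompact_sphere p R) hε
  obtain ⟨H, hH, hHP⟩ := exists_harmonic_polynomial_eq_on_sphere p hR P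
  exact ⟨polynomialMap H, harmonicOnNhd_polynomialMap hH univ, fun x hx => hHP x hx ▸ hP x hx⟩

end HarmonicPolynomials

section Harnack

open MeasureTheory

theorem hasDerivAt_max_zero_sq (t : ℝ) :
    HasDerivAt (fun t : ℝ => max 0 t ^ 2) (2 * max 0 t) t := by
  have hleft : ∀ s ≤ 0, HasDerivWithinAt (fun t : ℝ => max 0 t ^ 2) (2 * max 0 s) (Iic 0) s :=
    fun s hs => by
      rw [max_eq_left hs, mul_zero]
      refine (hasDerivWithinAt_const s _ (0 : ℝ)).congr_of_mem (fun t ht => ?_) hs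
      simp [max_eq_left (mem_Iic.mp ht)]
  have hright : ∀ s ≥ 0, HasDerivWithinAt (fun t : ℝ => max 0 t ^ 2) (2 * max 0 s) (Ici 0) s :=
    fun s hs => by
      rw [max_eq_right hs]
      refine HasDerivWithinAt.congr_of_mem (f := fun t => t ^ 2) (by simpa using
        (hasDerivAt_pow 2 s).hasDerivWithinAt) (fun t ht => ?_) hs
      simp [max_eq_right (mem_Ici.mp ht)]
  rcases lt_trichotomy t 0 with ht | rfl | ht
  · exact (hleft t ht.le).hasDerivAt (Iic_mem_nhds ht)
  · simpa using (hleft 0 le_rfl).union (hright 0 le_rfl)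
  · exact (hright t ht.le).hasDerivAt (Ici_mem_nhds ht)

variable {E : Type*} [NormedAddCommGroup E]

/-- The radial weight `(1 - |z|²)₊` of the averages in the mean value property. It is a
convenient choice because the gradient of its square is a multiple of the weight itself. -/
noncomputable def averagingKernel (z : E) : ℝ :=
  max 0 (1 - ‖z‖ ^ 2)

theorem averagingKernel_nonneg (z : E) : 0 ≤ averagingKernel z :=
  le_max_left _ _

theorem averagingKernel_le_one (z : E) : averagingKernel z ≤ 1 :=
  max_le zero_le_one (by nlinarith [norm_nonneg z])

theorem continuous_averagingKernel : Continuous (averagingKernel : E → ℝ) := by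
  unfold averagingKernel
  fun_prop

theorem averagingKernel_eq_zero {z : E} (hz : 1 ≤ ‖z‖) : averagingKernel z = 0 :=
  max_eq_left (by nlinarith)

theorem averagingKernel_le_three_mul [NormedSpace ℝ E] {x : E} (hx : ‖x‖ ≤ 9 / 16) (y : E) :
    averagingKernel y ≤ 3 * averagingKernel ((1 / 4 : ℝ) • y + x) := by
  rcases le_or_gt 1 ‖y‖ with hy | hy
  · rw [averagingKernel_eq_zero hy]
    exact mul_nonneg (by norm_num) (averagingKernel_nonneg _)
  have hnorm : ‖(1 / 4 : ℝ) • y + x‖ ≤ 13 / 16 := by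
    refine (norm_add_le _ _).trans ?_
    rw [norm_smul, Real.norm_of_nonneg (by norm_num)]
    linarith
  have hlower : 1 - ‖(1 / 4 : ℝ) • y + x‖ ^ 2 ≤ averagingKernel ((1 / 4 : ℝ) • y + x) :=
    le_max_right _ _
  nlinarith [averagingKernel_le_one y, norm_nonneg ((1 / 4 : ℝ) • y + x)]

variable [InnerProductSpace ℝ E]

theorem hasFDerivAt_averagingKernel_sq (z : E) :
    HasFDerivAt (fun z : E => averagingKernel z ^ 2)
      ((-4 * averagingKernel z) • innerSL ℝ z) z := by
  refine ((hasDerivAt_max_zero_sq (1 - ‖z‖ ^ 2)).comp_hasFDerivAt z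
    ((hasFDerivAt_id z).norm_sq.const_sub 1)).congr_fderiv ?_
  ext v
  simp only [averagingKernel, id_eq, smul_apply, neg_apply, innerSL_apply_apply, smul_eq_mul,
    ContinuousLinearMap.comp_id]
  ring

variable [FiniteDimensional ℝ E]

theorem hasCompactSupport_averagingKernel : HasCompactSupport (averagingKernel : E → ℝ) :=
  HasCompactSupport.intro (isCompact_closedBall 0 1) fun z hz =>
    averagingKernel_eq_zero (by simpa using (not_le.mp (mt mem_closedBall.mpr hz)).le)

variable [MeasurableSpace E] [BorelSpace E]

theorem integral_averagingKernel_pos : 0 < ∫ z : E, averagingKernel z :=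
  continuous_averagingKernel.integral_pos_of_hasCompactSupport_nonneg_nonzero
    hasCompactSupport_averagingKernel averagingKernel_nonneg (x := 0) (by simp [averagingKernel])

theorem integrable_averagingKernel_mul {f : E → ℝ} (hf : Continuous f) :
    Integrable fun z => averagingKernel z * f z :=
  (continuous_averagingKernel.mul hf).integrable_of_hasCompactSupport
    hasCompactSupport_averagingKernel.mul_right

theorem integrable_averagingKernel_sq_mul {f : E → ℝ} (hf : Continuous f) :
    Integrable fun z => averagingKernel z ^ 2 * f z := by
  simpa only [pow_two, mul_assoc, Pi.mul_apply] using
    integrable_averagingKernel_mul (continuous_averagingKernel.mul hf)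

theorem integral_averagingKernel_sq_mul_fderiv {g : E → ℝ} (hg : ContDiff ℝ 1 g) (e : E) :
    ∫ z, averagingKernel z ^ 2 * fderiv ℝ g z e
      = 4 * ∫ z, averagingKernel z * (inner ℝ z e * g z) := by
  have hfderiv (z : E) : fderiv ℝ (fun z : E => averagingKernel z ^ 2) z e * g z
      = averagingKernel z * (-4 * (inner ℝ z e * g z)) := by
    rw [(hasFDerivAt_averagingKernel_sq z).fderiv]
    simp only [smul_apply, innerSL_apply_apply, smul_eq_mul]
    ring
  have hg' : Continuous fun z => inner ℝ z e * g z := by have := hg.continuous; fun_prop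
  have hparts := integral_mul_fderiv_eq_neg_fderiv_mul_of_integrable (𝕜 := ℝ)
    (μ := (volume : Measure E)) (v := e) (f := fun z : E => averagingKernel z ^ 2) (g := g)
    (by simpa only [hfderiv] using integrable_averagingKernel_mul (hg'.const_mul (-4)))
    (integrable_averagingKernel_sq_mul
      ((hg.continuous_fderiv one_ne_zero).clm_apply continuous_const))
    (integrable_averagingKernel_sq_mul hg.continuous)
    (fun z _ => (hasFDerivAt_averagingKernel_sq z).differentiableAt)
    (fun z _ => hg.differentiable one_ne_zero z)
  rw [hparts, ← integral_neg, ← integral_const_mul]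
  congr 1 with z
  rw [hfderiv]
  ring

theorem integral_averagingKernel_sq_mul_divergence {ι : Type*} [Fintype ι]
    (b : OrthonormalBasis ι ℝ E) {X : E → E →L[ℝ] ℝ} (hX : ContDiff ℝ 1 X) :
    ∫ z, averagingKernel z ^ 2 * ∑ i, fderiv ℝ X z (b i) (b i)
      = 4 * ∫ z, averagingKernel z * X z z := by
  have hcoord (i : ι) : ContDiff ℝ 1 fun z => X z (b i) := hX.clm_apply contDiff_const
  have hfderiv (i : ι) (z : E) :
      fderiv ℝ X z (b i) (b i) = fderiv ℝ (fun z => X z (b i)) z (b i) := by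
    simp [fderiv_clm_apply (hX.differentiable one_ne_zero z) (differentiableAt_const (b i))]
  have hrepr (z : E) : X z z = ∑ i, inner ℝ z (b i) * X z (b i) := by
    conv_lhs => enter [2]; rw [← b.sum_repr' z]
    simp [real_inner_comm]
  simp only [hfderiv, hrepr, Finset.mul_sum]
  rw [integral_finsetSum _ fun i _ => integrable_averagingKernel_sq_mul
      (((hcoord i).continuous_fderiv one_ne_zero).clm_apply continuous_const),
    integral_finsetSum _ fun i _ => integrable_averagingKernel_mul
      (f := fun z => inner ℝ z (b i) * X z (b i))
      ((continuous_id.inner continuous_const).mul (hcoord i).continuous), Finset.mul_sum]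
  exact Finset.sum_congr rfl fun i _ => integral_averagingKernel_sq_mul_fderiv (hcoord i) (b i)

variable {V : E → ℝ}

theorem hasDerivAt_integral_averagingKernel_mul (hV : ContDiff ℝ 1 V) (x : E) (s : ℝ) :
    HasDerivAt (fun s : ℝ => ∫ z, averagingKernel z * V (s • z + x))
      (∫ z, averagingKernel z * fderiv ℝ V (s • z + x) z) s := by
  have hV' := hV.continuous_fderiv one_ne_zero
  have hcontV (t : ℝ) : Continuous fun z => V (t • z + x) := hV.continuous.comp (by fun_prop)
  obtain ⟨C, hC⟩ := (isCompact_closedBall x (|s| + 1)).exists_bound_of_continuousOn hV'.continuousOn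
  have hbound (z : E) (t : ℝ) (ht : t ∈ ball s 1) :
      ‖averagingKernel z * fderiv ℝ V (t • z + x) z‖ ≤ averagingKernel z * C := by
    rw [norm_mul, Real.norm_of_nonneg (averagingKernel_nonneg z)]
    rcases le_or_gt 1 ‖z‖ with hz | hz
    · simp [averagingKernel_eq_zero hz]
    have ht' : |t| ≤ |s| + 1 := by
      linarith [abs_sub_abs_le_abs_sub t s, Real.dist_eq t s ▸ mem_ball.mp ht]
    have hmem : t • z + x ∈ closedBall x (|s| + 1) := by
      rw [mem_closedBall, dist_eq_norm, add_sub_cancel_right, norm_smul, Real.norm_eq_abs]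
      nlinarith [abs_nonneg t, norm_nonneg z]
    refine mul_le_mul_of_nonneg_left (((fderiv ℝ V (t • z + x)).le_opNorm z).trans ?_)
      (averagingKernel_nonneg z)
    nlinarith [hC _ hmem, norm_nonneg z, norm_nonneg (fderiv ℝ V (t • z + x))]
  have hderiv (z : E) (t : ℝ) : HasDerivAt (fun t : ℝ => averagingKernel z * V (t • z + x))
      (averagingKernel z * fderiv ℝ V (t • z + x) z) t := by
    have hline : HasDerivAt (fun t : ℝ => t • z + x) z t := by
      simpa using ((hasDerivAt_id t).smul_const z).add_const x
    exact ((hV.differentiable one_ne_zero _).hasFDerivAt.comp_hasDerivAt t hline).const_mul _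
  exact (hasDerivAt_integral_of_dominated_loc_of_deriv_le (ball_mem_nhds s one_pos)
    (.of_forall fun t => (integrable_averagingKernel_mul (hcontV t)).aestronglyMeasurable)
    (integrable_averagingKernel_mul (hcontV s))
    (integrable_averagingKernel_mul
      ((hV'.comp (by fun_prop)).clm_apply continuous_id)).aestronglyMeasurable
    (.of_forall hbound) (integrable_averagingKernel_mul continuous_const)
    (.of_forall fun z t _ => hderiv z t)).2

theorem integral_averagingKernel_mul_fderiv_eq_zero (hV : HarmonicOnNhd V univ) (x : E) (s : ℝ) :
    ∫ z, averagingKernel z * fderiv ℝ V (s • z + x) z = 0 := by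
  have hX : ContDiff ℝ 1 fun z => fderiv ℝ V (s • z + x) :=
    ((contDiffOn_univ.mp hV.contDiffOn).fderiv_right (by norm_num)).comp (by fun_prop)
  have hdiv (z : E) : ∑ i, fderiv ℝ (fun z => fderiv ℝ V (s • z + x)) z
      (stdOrthonormalBasis ℝ E i) (stdOrthonormalBasis ℝ E i) = 0 := by
    simp only [fderiv_comp_smul_add, smul_apply, ← Finset.smul_sum,
      ← laplacian_eq_sum_fderiv, (hV _ (mem_univ _)).2.self_of_nhds, Pi.zero_apply, smul_zero]
  have hmean := integral_averagingKernel_sq_mul_divergence (stdOrthonormalBasis ℝ E) hX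
  simp only [hdiv, mul_zero, integral_zero] at hmean
  linarith

theorem integral_averagingKernel_mul_harmonic (hV : HarmonicOnNhd V univ) (x : E) (s : ℝ) :
    ∫ z, averagingKernel z * V (s • z + x) = V x * ∫ z : E, averagingKernel z := by
  have hderiv (t : ℝ) := hasDerivAt_integral_averagingKernel_mul
    ((contDiffOn_univ.mp hV.contDiffOn).of_le one_le_two) x t
  simp only [integral_averagingKernel_mul_fderiv_eq_zero hV] at hderiv
  rw [is_const_of_deriv_eq_zero (fun t => (hderiv t).differentiableAt) (fun t => (hderiv t).deriv)
    s 0]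
  simp only [zero_smul, zero_add]
  rw [integral_mul_const, mul_comm]

theorem le_mul_of_harmonicOnNhd_of_nonneg_unitBall (hV : HarmonicOnNhd V univ)
    (hnonneg : ∀ y ∈ closedBall 0 1, 0 ≤ V y) {x : E} (hx : ‖x‖ ≤ 9 / 16) :
    V x ≤ 3 * 4 ^ Module.finrank ℝ E * V 0 := by
  have hcont : Continuous V := (contDiffOn_univ.mp hV.contDiffOn).continuous
  set f : E → ℝ := fun z => averagingKernel z * V z
  have hf : Integrable f := integrable_averagingKernel_mul hcont
  have hscale : ∫ y, f ((1 / 4 : ℝ) • y + x) = 4 ^ Module.finrank ℝ E * ∫ z, f z := by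
    rw [Measure.integral_comp_smul volume (fun y => f (y + x)), integral_add_right_eq_self]
    simp
  have hpoint (y : E) : averagingKernel y * V ((1 / 4 : ℝ) • y + x)
      ≤ 3 * f ((1 / 4 : ℝ) • y + x) := by
    have hker := averagingKernel_le_three_mul hx y
    set z := (1 / 4 : ℝ) • y + x
    rcases le_or_gt 1 ‖z‖ with hz | hz
    · rw [averagingKernel_eq_zero hz, mul_zero] at hker
      simp [f, averagingKernel_eq_zero hz, hker.antisymm (averagingKernel_nonneg y)]
    · calc averagingKernel y * V z ≤ 3 * averagingKernel z * V z :=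
            mul_le_mul_of_nonneg_right hker (hnonneg z (by simpa using hz.le))
        _ = 3 * f z := mul_assoc _ _ _
  have hmono := integral_mono
    (integrable_averagingKernel_mul (f := fun y => V ((1 / 4 : ℝ) • y + x))
      (hcont.comp (by fun_prop)))
    (((hf.comp_add_right x).comp_smul (by norm_num)).const_mul 3) hpoint
  have hmean := integral_averagingKernel_mul_harmonic hV 0 1
  simp only [one_smul, add_zero] at hmean
  rw [integral_averagingKernel_mul_harmonic hV, integral_const_mul, hscale, hmean] at hmono
  exact le_of_mul_le_mul_right (hmono.trans_eq (by ring)) integral_averagingKernel_pos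

omit [MeasurableSpace E] [BorelSpace E] in
theorem harnack_inequality (hV : HarmonicOnNhd V univ) {p x : E} {R : ℝ} (hR : 0 < R)
    (hnonneg : ∀ y ∈ closedBall p R, 0 ≤ V y) (hx : ‖x - p‖ ≤ 9 / 16 * R) :
    V x ≤ 3 * 4 ^ Module.finrank ℝ E * V p := by
  borelize E
  have hscaled : HarmonicOnNhd (fun z => V (R • z + p)) univ := fun z _ =>
    harmonicAt_comp_smul_add (hV _ (mem_univ _))
  have hball : ∀ z ∈ closedBall (0 : E) 1, 0 ≤ V (R • z + p) := fun z hz => hnonneg _ (by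
    rw [mem_closedBall, dist_eq_norm, add_sub_cancel_right, norm_smul, Real.norm_of_nonneg hR.le]
    exact mul_le_of_le_one_right hR.le (by simpa using hz))
  have hnorm : ‖R⁻¹ • (x - p)‖ ≤ 9 / 16 := by
    rw [norm_smul, norm_inv, Real.norm_of_nonneg hR.le, inv_mul_le_iff₀ hR]
    linarith
  simpa [smul_inv_smul₀ hR.ne'] using
    le_mul_of_harmonicOnNhd_of_nonneg_unitBall hscaled hball hnorm

end Harnack

section Subharmonic

variable {n : ℕ} {U V : Set (EuclideanSpace ℝ (Fin n))} {u w : EuclideanSpace ℝ (Fin n) → EReal}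

theorem IsSubharmonicOn.le_harmonic_closedBall (hu : IsSubharmonicOn u U)
    {y : EuclideanSpace ℝ (Fin n)} {r : ℝ} (hr : 0 < r) (hsub : closedBall y r ⊆ U)
    {h : EuclideanSpace ℝ (Fin n) → ℝ} (hc : ContinuousOn h (closedBall y r))
    (hh : HarmonicOnNhd h (ball y r)) (hs : ∀ z ∈ sphere y r, u z ≤ h z) :
    ∀ z ∈ closedBall y r, u z ≤ h z := by
  rw [← ball_union_sphere]
  rintro z (hz | hz)
  · exact hu.le_harmonic y r hr hsub h hc hh hs z hz
  · exact hs z hz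

theorem IsSubharmonicOn.congr (hu : IsSubharmonicOn u U) (h : EqOn u w U) :
    IsSubharmonicOn w U where
  lt_top x hx := h hx ▸ hu.lt_top x hx
  upperSemicontinuousOn := fun x hx =>
    UpperSemicontinuousWithinAt.congr_of_eventuallyEq (hu.upperSemicontinuousOn x hx) hx
      h.eventuallyEq_nhdsWithin
  le_harmonic y r hr hsub f hc hf hs z hz := by
    rw [← h (hsub (ball_subset_closedBall hz))]
    exact hu.le_harmonic y r hr hsub f hc hf
      (fun x hx => (h (hsub (sphere_subset_closedBall hx))).trans_le (hs x hx)) z hz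

theorem IsSubharmonicOn.of_forall_lt_exists (hlt : ∀ x ∈ U, u x < ⊤)
    (husc : UpperSemicontinuousOn u U)
    (h : ∀ x ∈ U, ∀ t < u x, ∃ v, IsSubharmonicOn v U ∧ (∀ y ∈ U, v y ≤ u y) ∧ t < v x) :
    IsSubharmonicOn u U where
  lt_top := hlt
  upperSemicontinuousOn := husc
  le_harmonic y r hr hsub f hc hf hs z hz := by
    refine le_of_forall_lt fun t ht => ?_
    obtain ⟨v, hv, hvu, htv⟩ := h z (hsub (ball_subset_closedBall hz)) t ht
    exact htv.trans_le (hv.le_harmonic y r hr hsub f hc hf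
      (fun x hx => (hvu x (hsub (sphere_subset_closedBall hx))).trans (hs x hx)) z hz)

theorem IsSubharmonicOn.add_const (hu : IsSubharmonicOn u U) (k : ℝ) :
    IsSubharmonicOn (fun x => u x + k) U where
  lt_top x hx := EReal.add_lt_top (hu.lt_top x hx).ne (EReal.coe_ne_top k)
  upperSemicontinuousOn := hu.upperSemicontinuousOn.add' upperSemicontinuousOn_const
    fun _ _ => EReal.continuousAt_add (.inr (EReal.coe_ne_bot k)) (.inr (EReal.coe_ne_top k))
  le_harmonic y r hr hsub f hc hf hs z hz := by
    have hiff : ∀ x, u x + k ≤ f x ↔ u x ≤ (f x - k : ℝ) := fun x => by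
      rw [EReal.coe_sub, EReal.le_sub_iff_add_le (.inl (EReal.coe_ne_bot k))
        (.inl (EReal.coe_ne_top k))]
    exact (hiff z).mpr (hu.le_harmonic y r hr hsub (fun x => f x - k)
      (hc.sub continuousOn_const) (fun x hx => (hf x hx).sub (harmonicAt_const k))
      (fun x hx => (hiff x).mp (hs x hx)) z hz)

theorem IsSubharmonicOn.comp_smul_add (hu : IsSubharmonicOn u U) {a : ℝ} (ha : 0 < a)
    {v : EuclideanSpace ℝ (Fin n)} (hV : MapsTo (fun x => a • x + v) V U) :
    IsSubharmonicOn (fun x => u (a • x + v)) V where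
  lt_top x hx := hu.lt_top _ (hV hx)
  upperSemicontinuousOn := hu.upperSemicontinuousOn.comp (by fun_prop) hV
  le_harmonic y r hr hsub f hc hf hs z hz := by
    set ψ : EuclideanSpace ℝ (Fin n) → EuclideanSpace ℝ (Fin n) := fun q => a⁻¹ • q + -(a⁻¹ • v)
    have hψ : ∀ q, a • ψ q + v = q := fun q => by
      simp only [ψ, smul_add, smul_neg, smul_inv_smul₀ ha.ne', neg_add_cancel_right]
    have hψ' : ∀ x, ψ (a • x + v) = x := fun x => by
      simp only [ψ, smul_add, inv_smul_smul₀ ha.ne', add_neg_cancel_right]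
    have hdist : ∀ q, dist q (a • y + v) = a * dist (ψ q) y := fun q => by
      conv_lhs => rw [← hψ q]
      rw [dist_add_right, dist_smul₀, Real.norm_of_nonneg ha.le]
    have hball : ∀ q ∈ closedBall (a • y + v) (a * r), ψ q ∈ closedBall y r := fun q hq => by
      rw [mem_closedBall, hdist] at hq
      exact le_of_mul_le_mul_left hq ha
    have key := hu.le_harmonic (a • y + v) (a * r) (by positivity)
      (fun q hq => hψ q ▸ hV (hsub (hball q hq))) (f ∘ ψ)
      (hc.comp (by fun_prop) hball) (fun q hq => ?_) (fun q hq => ?_) (a • z + v) ?_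
    · simpa only [Function.comp_apply, hψ'] using key
    · rw [mem_ball, hdist] at hq
      exact harmonicAt_comp_smul_add (hf _ (lt_of_mul_lt_mul_left hq ha.le))
    · rw [mem_sphere, hdist] at hq
      simpa only [Function.comp_apply, hψ] using hs (ψ q) (mul_left_cancel₀ ha.ne' hq)
    · rw [mem_ball, hdist, hψ']
      exact mul_lt_mul_of_pos_left hz ha

theorem IsSubharmonicOn.max_const [Nontrivial (EuclideanSpace ℝ (Fin n))]
    (hu : IsSubharmonicOn u U) (m : ℝ) : IsSubharmonicOn (fun x => max (u x) m) U where
  lt_top x hx := max_lt (hu.lt_top x hx) (EReal.coe_lt_top m)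
  upperSemicontinuousOn := hu.upperSemicontinuousOn.sup upperSemicontinuousOn_const
  le_harmonic y r hr hsub f hc hf hs z hz :=
    max_le
      (hu.le_harmonic y r hr hsub f hc hf (fun x hx => (le_max_left _ _).trans (hs x hx)) z hz)
      (EReal.coe_le_coe (le_of_harmonicOnNhd_of_le hc hf
        (fun x hx => EReal.coe_le_coe_iff.mp ((le_max_right _ _).trans (hs x hx))) z
        (ball_subset_closedBall hz)))

theorem IsSubharmonicOn.exists_real_ge [Nontrivial (EuclideanSpace ℝ (Fin n))]
    (hu : IsSubharmonicOn u U) {φ : EuclideanSpace ℝ (Fin n) → ℝ} (hφ : ∀ x ∈ U, u x ≤ φ x)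
    {m : ℝ} (hm : ∀ x ∈ U, m ≤ φ x) :
    ∃ g : EuclideanSpace ℝ (Fin n) → ℝ, IsSubharmonicOn (fun x => (g x : EReal)) U ∧
      ∀ x ∈ U, u x ≤ g x ∧ m ≤ g x ∧ g x ≤ φ x := by
  have hmax : ∀ x ∈ U, (((max (u x) m).toReal : ℝ) : EReal) = max (u x) m := fun x hx =>
    EReal.coe_toReal ((hu.max_const m).lt_top x hx).ne
      ((EReal.bot_lt_coe m).trans_le (le_max_right _ _)).ne'
  refine ⟨fun x => (max (u x) m).toReal, (hu.max_const m).congr fun x hx => (hmax x hx).symm,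
    fun x hx => ?_⟩
  simp only [← EReal.coe_le_coe_iff, hmax x hx]
  exact ⟨le_max_left _ _, le_max_right _ _, max_le (hφ x hx) (EReal.coe_le_coe (hm x hx))⟩

end Subharmonic

section SupConvolution

open scoped NNReal

/-- The sup-convolution of `g` over `s` with the cone of slope `k`: the smallest `k`-Lipschitz
function on the whole space that lies above `g` on `s`, provided `g` is bounded above on `s`
(otherwise the supremum takes the junk value `0`). -/
noncomputable def supConvolution {X : Type*} [PseudoMetricSpace X] (s : Set X) (g : X → ℝ)
    (k : ℝ≥0) (x : X) : ℝ :=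
  ⨆ z : s, g z - k * dist x z

section PseudoMetricSpace

variable {X : Type*} [PseudoMetricSpace X] {s : Set X} {g : X → ℝ} {k : ℝ≥0}

theorem bddAbove_range_sub_mul_dist (hg : BddAbove (g '' s)) (x : X) :
    BddAbove (range fun z : s => g z - k * dist x z) := by
  obtain ⟨M, hM⟩ := hg
  refine ⟨M, forall_mem_range.mpr fun z => ?_⟩
  have : 0 ≤ k * dist x z := by positivity
  linarith [hM (mem_image_of_mem g z.2)]

theorem le_supConvolution (hg : BddAbove (g '' s)) (x : X) {z : X} (hz : z ∈ s) :
    g z - k * dist x z ≤ supConvolution s g k x :=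
  le_ciSup (bddAbove_range_sub_mul_dist hg x) ⟨z, hz⟩

theorem self_le_supConvolution (hg : BddAbove (g '' s)) {x : X} (hx : x ∈ s) :
    g x ≤ supConvolution s g k x := by
  simpa only [dist_self, mul_zero, sub_zero] using le_supConvolution (k := k) hg x hx

theorem lipschitzWith_supConvolution (hs : s.Nonempty) (hg : BddAbove (g '' s)) :
    LipschitzWith k (supConvolution s g k) := by
  have := hs.to_subtype
  refine LipschitzWith.of_le_add_mul k fun x y => ciSup_le fun z => ?_
  have hz := le_supConvolution (k := k) hg y z.2
  have htri : k * dist y z ≤ k * (dist x y + dist x z) := by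
    gcongr
    exact dist_triangle_left y z x
  linarith

theorem supConvolution_le_of_lipschitzOnWith {φ : X → ℝ} (hφ : LipschitzOnWith k φ s)
    (hgφ : ∀ z ∈ s, g z ≤ φ z) {x : X} (hx : x ∈ s) : supConvolution s g k x ≤ φ x := by
  have : Nonempty s := ⟨⟨x, hx⟩⟩
  refine ciSup_le fun z => ?_
  have hz := hφ.le_add_mul z.2 hx
  rw [dist_comm] at hz
  linarith [hgφ z z.2]

end PseudoMetricSpace

variable {n : ℕ} {U V : Set (EuclideanSpace ℝ (Fin n))} {g : EuclideanSpace ℝ (Fin n) → ℝ}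

/-- The sup-convolution is locally a supremum of translates of `g`: by the oscillation bound, the
points farther away than `δ` do not contribute. -/
theorem isSubharmonicOn_supConvolution (hg : IsSubharmonicOn (fun x => (g x : EReal)) U)
    {m M : ℝ} (hm : ∀ x ∈ U, m ≤ g x) (hM : ∀ x ∈ U, g x ≤ M) {δ : ℝ} {k : ℝ≥0}
    (hk : M - m ≤ k * δ) (hδ : 0 < δ) (hV : ∀ x ∈ V, ball x δ ⊆ U) :
    IsSubharmonicOn (fun x => (supConvolution U g k x : EReal)) V := by
  have hbdd : BddAbove (g '' U) := ⟨M, forall_mem_image.mpr hM⟩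
  have hVU : V ⊆ U := fun x hx => hV x hx (mem_ball_self hδ)
  have hcont (hU : U.Nonempty) : Continuous fun x => (supConvolution U g k x : EReal) :=
    continuous_coe_real_ereal.comp (lipschitzWith_supConvolution hU hbdd).continuous
  refine .of_forall_lt_exists (fun x _ => EReal.coe_lt_top _)
    (fun x hx => (hcont ⟨x, hVU hx⟩).continuousWithinAt.upperSemicontinuousWithinAt)
    fun x hx t ht => ?_
  have translate (v) (hv : ‖v‖ < δ) (hgt : t < (g (x + v) - k * ‖v‖ : ℝ)) :
      ∃ w, IsSubharmonicOn w V ∧ (∀ y ∈ V, w y ≤ supConvolution U g k y) ∧ t < w x := by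
    have hmaps : ∀ y ∈ V, y + v ∈ U := fun y hy => hV y hy (by simpa using hv)
    refine ⟨fun y => (g (y + v) : EReal) + (-(k * ‖v‖) : ℝ), ?_, fun y hy => ?_, ?_⟩
    · have := hg.comp_smul_add (V := V) one_pos (v := v)
        fun y hy => by simpa only [one_smul] using hmaps y hy
      simpa only [one_smul] using this.add_const _
    · have := le_supConvolution (k := k) hbdd y (hmaps y hy)
      rw [dist_self_add_right, sub_eq_add_neg] at this
      beta_reduce
      exact_mod_cast this
    · exact_mod_cast hgt
  have : Nonempty U := ⟨⟨x, hVU hx⟩⟩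
  induction t with
  | top => exact absurd ht (not_lt.mpr le_top)
  | bot => exact translate 0 (by simpa using hδ) (EReal.bot_lt_coe _)
  | coe t =>
    obtain ⟨z, hz⟩ := exists_lt_of_lt_ciSup (EReal.coe_lt_coe_iff.mp ht)
    rcases lt_or_ge (dist x z) δ with hnear | hfar
    · refine translate (z - x) (by rwa [← dist_eq_norm, dist_comm]) ?_
      rw [EReal.coe_lt_coe_iff, add_sub_cancel, ← dist_eq_norm, dist_comm]
      exact hz
    · refine translate 0 (by simpa using hδ) ?_
      have hmul : k * δ ≤ k * dist x z := by gcongr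
      rw [EReal.coe_lt_coe_iff, norm_zero, mul_zero, sub_zero, add_zero]
      linarith [hm x (hVU hx), hM z z.2]

/-- Since the sup-convolution is only subharmonic away from the boundary of the ball, it is
composed with the contraction of factor `1 - δ` towards the centre. -/
theorem IsSubharmonicOn.exists_continuous_of_bounds {c : EuclideanSpace ℝ (Fin n)}
    (hg : IsSubharmonicOn (fun x => (g x : EReal)) (ball c 1)) {m M : ℝ}
    (hm : ∀ x ∈ ball c 1, m ≤ g x) (hM : ∀ x ∈ ball c 1, g x ≤ M)
    {φ : EuclideanSpace ℝ (Fin n) → ℝ} {L : ℝ≥0} (hφ : LipschitzOnWith L φ (ball c 1))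
    (hle : ∀ x ∈ ball c 1, g x ≤ φ x) {δ : ℝ} (hδ : 0 < δ) (hδ1 : δ < 1) :
    ∃ F : EuclideanSpace ℝ (Fin n) → ℝ, Continuous F ∧
      IsSubharmonicOn (fun x => (F x : EReal)) (ball c 1) ∧ (∀ x ∈ ball c 1, F x ≤ φ x) ∧
      ∀ x, (1 - δ) • x + δ • c ∈ ball c 1 → g ((1 - δ) • x + δ • c) ≤ F x + L * δ := by
  have hbdd : BddAbove (g '' ball c 1) := ⟨M, forall_mem_image.mpr hM⟩
  obtain ⟨k, hLk, hk⟩ : ∃ k : ℝ≥0, L ≤ k ∧ M - m ≤ k * δ :=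
    ⟨max L ((M - m) / δ).toNNReal, le_max_left _ _, (div_le_iff₀ hδ).mp
      ((Real.le_coe_toNNReal _).trans (NNReal.coe_le_coe.mpr (le_max_right _ _)))⟩
  have hmem : ∀ x ∈ ball c 1, (1 - δ) • x + δ • c ∈ ball c (1 - δ) := fun x hx => by
    rw [mem_ball, ← AffineMap.lineMap_apply_module, dist_lineMap_right,
      Real.norm_of_nonneg (by linarith)]
    exact mul_lt_of_lt_one_right (by linarith) hx
  have hsub : ball c (1 - δ) ⊆ ball c 1 := ball_subset_ball (by linarith)
  refine ⟨fun x => supConvolution (ball c 1) g k ((1 - δ) • x + δ • c) - L * δ, ?_, ?_,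
    fun x hx => ?_, fun x hx => ?_⟩
  · have := (lipschitzWith_supConvolution (k := k) ⟨c, mem_ball_self one_pos⟩ hbdd).continuous
    fun_prop
  · have hS : IsSubharmonicOn (fun x => (supConvolution (ball c 1) g k x : EReal))
        (ball c (1 - δ)) :=
      isSubharmonicOn_supConvolution hg hm hM hk hδ fun x hx =>
        ball_subset_ball' (by linarith [mem_ball.mp hx])
    simpa only [sub_eq_add_neg, EReal.coe_add] using
      (hS.comp_smul_add (by linarith) hmem).add_const (-(L * δ))
  · have hshift : dist ((1 - δ) • x + δ • c) x ≤ δ := by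
      rw [← AffineMap.lineMap_apply_module, dist_lineMap_left, Real.norm_of_nonneg hδ.le]
      exact mul_le_of_le_one_right hδ.le (mem_ball.mp hx).le
    have hS := supConvolution_le_of_lipschitzOnWith (hφ.weaken hLk) hle (hsub (hmem x hx))
    have hLδ : L * dist ((1 - δ) • x + δ • c) x ≤ L * δ := by gcongr
    linarith [hφ.le_add_mul (hsub (hmem x hx)) hx]
  · rw [sub_add_cancel]
    exact self_le_supConvolution hbdd hx

theorem IsSubharmonicOn.exists_continuous [Nontrivial (EuclideanSpace ℝ (Fin n))]
    {c : EuclideanSpace ℝ (Fin n)} {u : EuclideanSpace ℝ (Fin n) → EReal}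
    (hu : IsSubharmonicOn u (ball c 1)) {φ : EuclideanSpace ℝ (Fin n) → ℝ} {L : ℝ≥0}
    (hφ : LipschitzOnWith L φ (ball c 1)) (hle : ∀ x ∈ ball c 1, u x ≤ φ x)
    {δ : ℝ} (hδ : 0 < δ) (hδ1 : δ < 1) :
    ∃ F : EuclideanSpace ℝ (Fin n) → ℝ, Continuous F ∧
      IsSubharmonicOn (fun x => (F x : EReal)) (ball c 1) ∧ (∀ x ∈ ball c 1, F x ≤ φ x) ∧
      ∀ x, (1 - δ) • x + δ • c ∈ ball c 1 → u ((1 - δ) • x + δ • c) ≤ (F x + L * δ : ℝ) := by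
  have hosc : ∀ x ∈ ball c 1, |φ x - φ c| ≤ L := fun x hx =>
    (hφ.dist_le_mul x hx c (mem_ball_self one_pos)).trans
      (mul_le_of_le_one_right L.coe_nonneg (mem_ball.mp hx).le)
  obtain ⟨g, hg, hgb⟩ := hu.exists_real_ge hle fun x hx => sub_le_of_abs_sub_le_left (hosc x hx)
  have hgM : ∀ x ∈ ball c 1, g x ≤ φ c + L := fun x hx => by
    linarith [(hgb x hx).2.2, le_of_abs_le (hosc x hx)]
  obtain ⟨F, hFc, hF, hFφ, hgF⟩ := hg.exists_continuous_of_bounds (fun x hx => (hgb x hx).2.1)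
    hgM hφ (fun x hx => (hgb x hx).2.2) hδ hδ1
  exact ⟨F, hFc, hF, hFφ, fun x hx => (hgb _ hx).1.trans (EReal.coe_le_coe (hgF x hx))⟩

end SupConvolution

section Comparison

variable {E : Type*} [NormedAddCommGroup E] [InnerProductSpace ℝ E] [FiniteDimensional ℝ E]

theorem laplacian_sub_of_harmonicAt {f h : E → ℝ} {x : E} (hf : ContDiffAt ℝ 2 f x)
    (hh : HarmonicAt h x) : (Δ fun z => f z - h z) x = (Δ f) x := by
  refine (hf.laplacian_sub hh.1).trans ?_
  rw [hh.2.self_of_nhds, Pi.zero_apply, sub_zero]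

theorem le_harmonic_of_laplacian_pos {W h : E → ℝ} {p y : E} {R r : ℝ}
    (hWc : ContinuousOn W (closedBall p R))
    (hW : ∀ x ∈ ball p R, ContDiffAt ℝ 2 W x ∧ 0 < (Δ W) x)
    (hc : ContinuousOn h (closedBall y r)) (hh : HarmonicOnNhd h (ball y r))
    (hp : ∀ x ∈ sphere p R ∩ closedBall y r, W x ≤ h x)
    (hy : ∀ x ∈ ball p R ∩ sphere y r, W x ≤ h x) :
    ∀ x ∈ closedBall p R ∩ closedBall y r, W x ≤ h x := by
  suffices hsub : ∀ x ∈ closedBall p R ∩ closedBall y r, W x - h x ≤ 0 from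
    fun x hx => sub_nonpos.mp (hsub x hx)
  refine le_of_laplacian_pos ((isCompact_closedBall p R).inter_right isClosed_closedBall)
    ((hWc.mono inter_subset_left).sub (hc.mono inter_subset_right)) fun x hx hpos => ?_
  have hxp : x ∈ ball p R := by
    have hx₁ := hx.1
    rw [← ball_union_sphere] at hx₁
    exact hx₁.resolve_right fun hxs => by linarith [hp x ⟨hxs, hx.2⟩]
  have hxy : x ∈ ball y r := by
    have hx₂ := hx.2
    rw [← ball_union_sphere] at hx₂
    exact hx₂.resolve_right fun hxs => by linarith [hy x ⟨hxp, hxs⟩]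
  refine ⟨Filter.mem_of_superset ((isOpen_ball.inter isOpen_ball).mem_nhds ⟨hxp, hxy⟩)
    (inter_subset_inter ball_subset_closedBall ball_subset_closedBall),
    (hW x hxp).1.sub (hh x hxy).1, ?_⟩
  rw [laplacian_sub_of_harmonicAt (hW x hxp).1 (hh x hxy)]
  exact (hW x hxp).2

end Comparison

section Semiconcave

variable {E : Type*} [NormedAddCommGroup E] [InnerProductSpace ℝ E] {U V : Set E} {φ ψ : E → ℝ}
  {K N : ℝ} {y g : E}

/-- `g` is a proximal supergradient of `φ` at `y` relative to `U`, with constant `K`: the paraboloid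
`z ↦ φ y + ⟪g, z - y⟫ + K * ‖z - y‖ ^ 2` touches `φ` from above at `y`. -/
def IsProximalSupergradient (U : Set E) (φ : E → ℝ) (K : ℝ) (y g : E) : Prop :=
  ∀ z ∈ U, φ z ≤ φ y + inner ℝ g (z - y) + K * ‖z - y‖ ^ 2

/-- Semiconcavity of `φ` on `U` with constant `K`: at every point of `U` the function is touched
from above by a paraboloid of opening `K`. On a convex set this says that `φ - K * ‖·‖ ^ 2` is
concave, in a form that does not need second derivatives. -/
def IsSemiconcaveOn (U : Set E) (φ : E → ℝ) (K : ℝ) : Prop :=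
  ∀ y ∈ U, ∃ g, IsProximalSupergradient U φ K y g

theorem IsProximalSupergradient.mono (h : IsProximalSupergradient U φ K y g) (hVU : V ⊆ U)
    (hKN : K ≤ N) : IsProximalSupergradient V φ N y g := fun z hz =>
  (h z (hVU hz)).trans (by gcongr)

theorem IsProximalSupergradient.of_le (h : IsProximalSupergradient U ψ K y g)
    (hle : ∀ z ∈ U, φ z ≤ ψ z) (hy : φ y = ψ y) : IsProximalSupergradient U φ K y g :=
  fun z hz => hy ▸ (hle z hz).trans (h z hz)

theorem IsSemiconcaveOn.mono (h : IsSemiconcaveOn U φ K) (hVU : V ⊆ U) (hKN : K ≤ N) :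
    IsSemiconcaveOn V φ N :=
  fun y hy => (h y (hVU hy)).imp fun _ hg => hg.mono hVU hKN

/-- At an interior maximum of `W - φ`, a paraboloid touching `φ` from above would touch `W` from
above as well, which the size of the Laplacian of `W` forbids. -/
theorem IsSemiconcaveOn.le_of_lt_laplacian [FiniteDimensional ℝ E] {p : E} {R : ℝ}
    (hφ : IsSemiconcaveOn (ball p R) φ K) (hφc : ContinuousOn φ (closedBall p R)) {W : E → ℝ}
    (hWc : ContinuousOn W (closedBall p R)) (hW : ∀ x ∈ ball p R, ContDiffAt ℝ 2 W x)
    (hΔ : ∀ x ∈ ball p R, K * (2 * Module.finrank ℝ E) < (Δ W) x)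
    (hle : ∀ x ∈ sphere p R, W x ≤ φ x) : ∀ x ∈ closedBall p R, W x ≤ φ x := by
  intro x hx
  obtain ⟨q, hq, hmax⟩ := (isCompact_closedBall p R).exists_isMaxOn ⟨x, hx⟩ (hWc.sub hφc)
  by_contra! hlt
  have hxq : W x - φ x ≤ W q - φ q := hmax hx
  have hqb : q ∈ ball p R := by
    rw [← ball_union_sphere] at hq
    exact hq.resolve_right fun hqs => by linarith [hle q hqs]
  obtain ⟨g, hg⟩ := hφ q hqb
  have hl : HarmonicAt (innerSL ℝ g) q := harmonicAt_continuousLinearMap _ q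
  have hWl : ContDiffAt ℝ 2 (fun z => W z - innerSL ℝ g z) q := (hW q hqb).sub hl.1
  refine not_isLocalMax_of_laplacian_pos (contDiffAt_add_mul_norm_sub_sq hWl (-K) 0 q) ?_ ?_
  · rw [laplacian_add_mul_norm_sub_sq hWl, laplacian_sub_of_harmonicAt (hW q hqb) hl]
    linarith [hΔ q hqb]
  · filter_upwards [isOpen_ball.mem_nhds hqb] with z hz
    have hzq : W z - φ z ≤ W q - φ q := hmax (ball_subset_closedBall hz)
    have hgz := hg z hz
    rw [inner_sub_right] at hgz
    simp only [innerSL_apply_apply, sub_self, norm_zero]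
    linarith

end Semiconcave

section Envelope

variable {n : ℕ} {U : Set (EuclideanSpace ℝ (Fin n))} {φ : EuclideanSpace ℝ (Fin n) → ℝ}

theorem le_subharmonicEnvelope {u : EuclideanSpace ℝ (Fin n) → EReal} (hu : IsSubharmonicOn u U)
    (hle : ∀ z ∈ U, u z ≤ φ z) (x : EuclideanSpace ℝ (Fin n)) :
    u x ≤ subharmonicEnvelope U φ x :=
  le_sSup ⟨u, hu, hle, rfl⟩

theorem subharmonicEnvelope_le {x : EuclideanSpace ℝ (Fin n)} (hx : x ∈ U) :
    subharmonicEnvelope U φ x ≤ φ x := by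
  refine sSup_le ?_
  rintro _ ⟨u, -, hle, rfl⟩
  exact hle x hx

theorem exists_isSubharmonicOn_of_lt_subharmonicEnvelope {x : EuclideanSpace ℝ (Fin n)} {t : EReal}
    (ht : t < subharmonicEnvelope U φ x) :
    ∃ u, IsSubharmonicOn u U ∧ (∀ z ∈ U, u z ≤ φ z) ∧ t < u x := by
  obtain ⟨_, ⟨u, hu, hle, rfl⟩, htu⟩ := lt_sSup_iff.mp ht
  exact ⟨u, hu, hle, htu⟩

open Classical in
theorem IsSubharmonicOn.piecewise_max {F : EuclideanSpace ℝ (Fin n) → ℝ}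
    (hF : IsSubharmonicOn (fun x => (F x : EReal)) U) (hFc : Continuous F)
    {p : EuclideanSpace ℝ (Fin n)} {R : ℝ} (hR : 0 < R) {W : EuclideanSpace ℝ (Fin n) → ℝ}
    (hWc : ContinuousOn W (closedBall p R))
    (hW : ∀ x ∈ ball p R, ContDiffAt ℝ 2 W x ∧ 0 < (Δ W) x) (hWF : ∀ x ∈ sphere p R, W x ≤ F x) :
    IsSubharmonicOn
      (fun x => ((ball p R).piecewise (fun x => max (F x) (W x)) F x : EReal)) U := by
  set G := (ball p R).piecewise (fun x => max (F x) (W x)) F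
  have hGin : ∀ x ∈ ball p R, G x = max (F x) (W x) := fun x hx => piecewise_eq_of_mem _ _ _ hx
  have hGout : ∀ x ∉ ball p R, G x = F x := fun x hx => piecewise_eq_of_notMem _ _ _ hx
  have hFG : ∀ x, F x ≤ G x := fun x => by
    by_cases hx : x ∈ ball p R
    · exact (le_max_left _ _).trans_eq (hGin x hx).symm
    · exact (hGout x hx).ge
  have hGc : Continuous G := by
    refine continuous_piecewise (fun x hx => ?_) ?_ hFc.continuousOn
    · rw [frontier_ball p hR.ne'] at hx
      exact max_eq_left (hWF x hx)
    · rw [closure_ball p hR.ne']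
      exact ContinuousOn.sup hFc.continuousOn hWc
  refine ⟨fun x _ => EReal.coe_lt_top _,
    (continuous_coe_real_ereal.comp hGc).upperSemicontinuous.upperSemicontinuousOn _, ?_⟩
  intro y r hr hsub h hc hh hs z hz
  simp only [EReal.coe_le_coe_iff] at hs ⊢
  have hFh : ∀ x ∈ closedBall y r, F x ≤ h x := fun x hx =>
    EReal.coe_le_coe_iff.mp (hF.le_harmonic_closedBall hr hsub hc hh
      (fun w hw => EReal.coe_le_coe ((hFG w).trans (hs w hw))) x hx)
  have hWh := le_harmonic_of_laplacian_pos hWc hW hc hh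
    (fun x hx => (hWF x hx.1).trans (hFh x hx.2))
    fun x hx => ((le_max_right _ _).trans_eq (hGin x hx.1).symm).trans (hs x hx.2)
  by_cases hzp : z ∈ ball p R
  · rw [hGin z hzp]
    exact max_le (hFh z (ball_subset_closedBall hz))
      (hWh z ⟨ball_subset_closedBall hzp, ball_subset_closedBall hz⟩)
  · rw [hGout z hzp]
    exact hFh z (ball_subset_closedBall hz)

end Envelope

section MemC11

variable {n : ℕ} {U : Set (EuclideanSpace ℝ (Fin n))} {f : EuclideanSpace ℝ (Fin n) → ℝ}

theorem MemC11.nnnorm_gradient_le (hf : MemC11 U f) {x : EuclideanSpace ℝ (Fin n)} (hx : x ∈ U) :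
    ‖∇ f x‖₊ ≤ (c2Norm U f).toNNReal := by
  refine ENNReal.le_toNNReal_of_coe_le ?_ hf.2.ne
  rw [← enorm_eq_nnnorm]
  exact (le_iSup₂ (f := fun x (_ : x ∈ U) => ‖∇ f x‖ₑ) x hx).trans
    (le_add_self.trans le_self_add)

theorem MemC11.lipschitzOnWith_gradient (hf : MemC11 U f) :
    LipschitzOnWith (c2Norm U f).toNNReal (∇ f) U := by
  intro x hx y hy
  rw [ENNReal.coe_toNNReal hf.2.ne, edist_eq_enorm_sub]
  rcases eq_or_ne x y with rfl | hxy
  · simp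
  rw [← ENNReal.div_le_iff (edist_pos.mpr hxy).ne' (edist_ne_top x y)]
  exact ((le_iSup₂ (f := fun y (_ : y ∈ U) => ‖∇ f x - ∇ f y‖ₑ / edist x y) y hy).trans
    (le_iSup₂ (f := fun x (_ : x ∈ U) => ⨆ y ∈ U, ‖∇ f x - ∇ f y‖ₑ / edist x y) x hx)).trans
    le_add_self

theorem MemC11.hasFDerivAt (hf : MemC11 U f) (hU : IsOpen U) {x : EuclideanSpace ℝ (Fin n)}
    (hx : x ∈ U) : HasFDerivAt f (innerSL ℝ (∇ f x)) x :=
  (hf.1.differentiableAt (hU.mem_nhds hx)).hasGradientAt.hasFDerivAt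

theorem MemC11.lipschitzOnWith (hf : MemC11 U f) (hU : IsOpen U) (hconv : Convex ℝ U) :
    LipschitzOnWith (c2Norm U f).toNNReal f U :=
  hconv.lipschitzOnWith_of_nnnorm_hasFDerivWithin_le
    (fun _ hx => (hf.hasFDerivAt hU hx).hasFDerivWithinAt) fun x hx => by
      rw [← NNReal.coe_le_coe, coe_nnnorm, innerSL_apply_norm]
      exact hf.nnnorm_gradient_le hx

theorem MemC11.isProximalSupergradient (hf : MemC11 U f) (hU : IsOpen U) (hconv : Convex ℝ U)
    {x : EuclideanSpace ℝ (Fin n)} (hx : x ∈ U) :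
    IsProximalSupergradient U f (c2Norm U f).toNNReal x (∇ f x) := by
  intro y hy
  have hseg : segment ℝ x y ⊆ U := hconv.segment_subset hx hy
  have htaylor : |f y - f x - inner ℝ (∇ f x) (y - x)| ≤
      (c2Norm U f).toNNReal * ‖y - x‖ * ‖y - x‖ := by
    refine (convex_segment x y).norm_image_sub_le_of_norm_hasFDerivWithin_le'
      (f' := fun z => innerSL ℝ (∇ f z)) (φ := innerSL ℝ (∇ f x))
      (fun z hz => (hf.hasFDerivAt hU (hseg hz)).hasFDerivWithinAt) (fun z hz => ?_)
      (left_mem_segment ℝ x y) (right_mem_segment ℝ x y)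
    rw [← map_sub, innerSL_apply_norm]
    refine (hf.lipschitzOnWith_gradient.norm_sub_le (hseg hz) hx).trans ?_
    gcongr
    exact norm_sub_le_of_mem_segment hz
  linarith [le_of_abs_le htaylor]

theorem lipschitzOnWith_min_of_memC11 {b : Fin 2 → EuclideanSpace ℝ (Fin n) → ℝ}
    (hb : ∀ j, MemC11 U (b j)) (hU : IsOpen U) (hconv : Convex ℝ U) :
    LipschitzOnWith (max (c2Norm U (b 0)).toNNReal (c2Norm U (b 1)).toNNReal)
      (fun z => min (b 0 z) (b 1 z)) U := by
  simpa only [one_mul, Function.comp_def] using lipschitzWith_min.comp_lipschitzOnWith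
    (((hb 0).lipschitzOnWith hU hconv).prodMk ((hb 1).lipschitzOnWith hU hconv))

theorem isProximalSupergradient_min_of_memC11 {b : Fin 2 → EuclideanSpace ℝ (Fin n) → ℝ}
    (hb : ∀ j, MemC11 U (b j)) (hU : IsOpen U) (hconv : Convex ℝ U)
    {x : EuclideanSpace ℝ (Fin n)} (hx : x ∈ U) {i : Fin 2} (hi : min (b 0 x) (b 1 x) = b i x) :
    IsProximalSupergradient U (fun z => min (b 0 z) (b 1 z))
      (max (c2Norm U (b 0)).toNNReal (c2Norm U (b 1)).toNNReal) x (∇ (b i) x) := by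
  have hK : ∀ j, (c2Norm U (b j)).toNNReal ≤
      max (c2Norm U (b 0)).toNNReal (c2Norm U (b 1)).toNNReal :=
    Fin.forall_fin_two.mpr ⟨le_max_left _ _, le_max_right _ _⟩
  have hmin : ∀ j z, min (b 0 z) (b 1 z) ≤ b j z :=
    Fin.forall_fin_two.mpr ⟨fun _ => min_le_left _ _, fun _ => min_le_right _ _⟩
  exact (((hb i).isProximalSupergradient hU hconv hx).mono Subset.rfl
    (NNReal.coe_le_coe.mpr (hK i))).of_le (fun z _ => hmin i z) hi

theorem isSemiconcaveOn_min_of_memC11 {b : Fin 2 → EuclideanSpace ℝ (Fin n) → ℝ}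
    (hb : ∀ j, MemC11 U (b j)) (hU : IsOpen U) (hconv : Convex ℝ U) :
    IsSemiconcaveOn U (fun z => min (b 0 z) (b 1 z))
      (max (c2Norm U (b 0)).toNNReal (c2Norm U (b 1)).toNNReal) := fun x hx =>
  (min_choice (b 0 x) (b 1 x)).elim
    (fun h => ⟨_, isProximalSupergradient_min_of_memC11 hb hU hconv hx h⟩)
    fun h => ⟨_, isProximalSupergradient_min_of_memC11 hb hU hconv hx h⟩

end MemC11

section ContactPoint

open scoped NNReal

variable {n : ℕ} {U : Set (EuclideanSpace ℝ (Fin n))} {F H φ : EuclideanSpace ℝ (Fin n) → ℝ}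
  {c g p x x₀ : EuclideanSpace ℝ (Fin n)} {K : ℝ≥0} {R δ : ℝ}

theorem IsSubharmonicOn.exists_harmonic_le_sphere [NeZero n]
    (hF : IsSubharmonicOn (fun x => (F x : EReal)) U) (hFc : Continuous F) (hR : 0 < R)
    (hsub : closedBall p R ⊆ U) {ε : ℝ} (hε : 0 < ε) :
    ∃ H, HarmonicOnNhd H univ ∧ (∀ y ∈ sphere p R, H y ≤ F y) ∧ F p ≤ H p + ε := by
  obtain ⟨H, hH, hHF⟩ := exists_harmonic_near_on_sphere p hR
    (F := fun y => F y - ε / 2) (by fun_prop) (half_pos hε)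
  refine ⟨H, hH, fun y hy => by linarith [(abs_lt.mp (hHF y hy)).2], ?_⟩
  have hHε : HarmonicOnNhd (fun y => H y + ε) univ :=
    fun y hy => (hH y hy).add (harmonicAt_const ε)
  refine EReal.coe_le_coe_iff.mp (hF.le_harmonic p R hR hsub (fun y => H y + ε)
    (fun y _ => (hHε y (mem_univ y)).1.continuousAt.continuousWithinAt)
    (hHε.mono (subset_univ _)) (fun y hy => ?_) p (mem_ball_self hR))
  exact EReal.coe_le_coe (by linarith [(abs_lt.mp (hHF y hy)).1])

theorem IsSubharmonicOn.harmonic_add_le_subharmonicEnvelope [NeZero n]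
    (hF : IsSubharmonicOn (fun x => (F x : EReal)) U) (hFc : Continuous F)
    (hFφ : ∀ y ∈ U, F y ≤ φ y) (hφc : ContinuousOn φ U) (hφ : IsSemiconcaveOn U φ K)
    (hR : 0 < R) (hsub : closedBall p R ⊆ U) (hH : HarmonicOnNhd H univ)
    (hHF : ∀ y ∈ sphere p R, H y ≤ F y) (hx : x ∈ ball p R) :
    (H x + (K + 1) * (‖x - p‖ ^ 2 - R ^ 2) : ℝ) ≤ subharmonicEnvelope U φ x := by
  classical
  set W : EuclideanSpace ℝ (Fin n) → ℝ := fun y => H y + (K + 1) * (‖y - p‖ ^ 2 - R ^ 2)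
  have hWs : ∀ y ∈ sphere p R, W y ≤ F y := fun y hy => by
    simp only [W, mem_sphere_iff_norm.mp hy, sub_self, mul_zero, add_zero]
    exact hHF y hy
  have hW : ∀ y, ContDiffAt ℝ 2 W y := fun y =>
    contDiffAt_add_mul_norm_sub_sq (hH y (mem_univ y)).1 _ _ p
  have hWc : ContinuousOn W (closedBall p R) := fun y _ => (hW y).continuousAt.continuousWithinAt
  have hΔ : ∀ y, (Δ W) y = ((K : ℝ) + 1) * (2 * n) := fun y => by
    refine (laplacian_add_mul_norm_sub_sq (hH y (mem_univ y)).1 _ _ p).trans ?_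
    rw [(hH y (mem_univ y)).2.self_of_nhds, Pi.zero_apply, zero_add, finrank_euclideanSpace_fin]
  have hn : (0 : ℝ) < n := Nat.cast_pos.mpr (NeZero.pos n)
  have hWφ : ∀ y ∈ closedBall p R, W y ≤ φ y :=
    IsSemiconcaveOn.le_of_lt_laplacian (K := K)
      (hφ.mono (ball_subset_closedBall.trans hsub) le_rfl)
      (hφc.mono hsub) hWc (fun y _ => hW y)
      (fun y _ => by rw [hΔ, finrank_euclideanSpace_fin]; linarith)
      fun y hy => (hWs y hy).trans (hFφ y (hsub (sphere_subset_closedBall hy)))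
  have hG := hF.piecewise_max hFc hR hWc
    (fun y _ => ⟨hW y, by rw [hΔ]; positivity⟩) hWs
  refine le_trans ?_ (le_subharmonicEnvelope hG (fun y hy => EReal.coe_le_coe ?_) x)
  · rw [piecewise_eq_of_mem _ _ _ hx]
    exact EReal.coe_le_coe (le_max_right _ _)
  · by_cases hyp : y ∈ ball p R
    · rw [piecewise_eq_of_mem _ _ _ hyp]
      exact max_le (hFφ y hy) (hWφ y (ball_subset_closedBall hyp))
    · rw [piecewise_eq_of_notMem _ _ _ hyp]
      exact hFφ y hy

theorem exists_smul_add_smul_eq (hx₀ : x₀ ∈ ball c (1 / 4)) (hδ : 0 ≤ δ) (hδ' : δ ≤ 3 / 4) :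
    ∃ p, (1 - δ) • p + δ • c = x₀ ∧ ‖p - x₀‖ ≤ δ := by
  have hδ₁ : 0 < 1 - δ := by linarith
  refine ⟨x₀ + (δ / (1 - δ)) • (x₀ - c), ?_, ?_⟩
  · rw [smul_add, smul_smul, mul_div_cancel₀ _ hδ₁.ne']
    module
  · rw [add_sub_cancel_left, norm_smul, Real.norm_of_nonneg (by positivity), div_mul_eq_mul_div,
      div_le_iff₀ hδ₁]
    gcongr
    linarith [mem_ball_iff_norm.mp hx₀]

/-- A subharmonic function that almost attains the envelope at `x₀` is regularized, at the cost of
moving the point `x₀` to a nearby point `p`. -/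
theorem exists_harmonic_of_mem_contactSet [NeZero n] (hφL : LipschitzOnWith K φ (ball c 1))
    (hφ : IsSemiconcaveOn (ball c 1) φ K) (hx₀ : x₀ ∈ contactSet (ball c 1) φ)
    (hx₀c : x₀ ∈ ball c (1 / 4)) (hδ : 0 < δ) (hR : 0 < R) (hδR : δ + R ≤ 3 / 4) :
    ∃ p H, ‖p - x₀‖ ≤ δ ∧ closedBall p R ⊆ ball c 1 ∧ HarmonicOnNhd H univ ∧
      (∀ y ∈ sphere p R, H y ≤ φ y) ∧ φ x₀ ≤ H p + (K + 2) * δ ∧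
      ∀ y ∈ ball p R, (H y + (K + 1) * (‖y - p‖ ^ 2 - R ^ 2) : ℝ) ≤
        subharmonicEnvelope (ball c 1) φ y := by
  obtain ⟨u, hu, huφ, hux₀⟩ := exists_isSubharmonicOn_of_lt_subharmonicEnvelope
    (hx₀.2 ▸ EReal.coe_lt_coe (sub_lt_self (φ x₀) hδ))
  obtain ⟨F, hFc, hF, hFφ, huF⟩ := hu.exists_continuous hφL huφ hδ (by linarith)
  obtain ⟨p, hpx₀, hp⟩ := exists_smul_add_smul_eq hx₀c hδ.le (by linarith)
  have hsub : closedBall p R ⊆ ball c 1 := by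
    refine closedBall_subset_ball' ?_
    linarith [dist_triangle p x₀ c, mem_ball.mp hx₀c, dist_eq_norm p x₀]
  obtain ⟨H, hH, hHF, hHp⟩ := hF.exists_harmonic_le_sphere hFc hR hsub hδ
  refine ⟨p, H, hp, hsub, hH,
    fun y hy => (hHF y hy).trans (hFφ y (hsub (sphere_subset_closedBall hy))), ?_,
    fun y hy => hF.harmonic_add_le_subharmonicEnvelope hFc hFφ hφL.continuousOn hφ hR hsub hH hHF
      hy⟩
  have hFp : φ x₀ - δ < F p + K * δ :=
    EReal.coe_lt_coe_iff.mp (hux₀.trans_le (hpx₀ ▸ huF p (hpx₀ ▸ hx₀.1)))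
  linarith

theorem IsProximalSupergradient.inner_le {E : Type*} [NormedAddCommGroup E]
    [InnerProductSpace ℝ E] {U : Set E} {φ : E → ℝ} {N : ℝ} {y g v : E}
    (hg : IsProximalSupergradient U φ N y g) (hφ : LipschitzOnWith K φ U) (hy : y ∈ U)
    (hv : y - v ∈ U) : inner ℝ g v ≤ K * ‖v‖ + N * ‖v‖ ^ 2 := by
  have hlip := hφ.le_add_mul hy hv
  have hgv := hg _ hv
  rw [dist_self_sub_right] at hlip
  rw [sub_sub_cancel_left, inner_neg_right, norm_neg] at hgv
  linarith

/-- Harnack's inequality for the difference of the paraboloid touching `φ` at `x₀`, with its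
quadratic part frozen at its maximum over the ball, and `H`. -/
theorem IsProximalSupergradient.sub_harmonic_le [NeZero n]
    (hg : IsProximalSupergradient U φ K x₀ g) (hR : 0 < R) (hsub : sphere p R ⊆ U)
    (hH : HarmonicOnNhd H univ) (hHφ : ∀ y ∈ sphere p R, H y ≤ φ y) (hx : ‖x - p‖ ≤ 9 / 16 * R) :
    φ x₀ + inner ℝ g (x - x₀) + K * (R + ‖p - x₀‖) ^ 2 - H x ≤
      3 * 4 ^ n * (φ x₀ + inner ℝ g (p - x₀) + K * (R + ‖p - x₀‖) ^ 2 - H p) := by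
  set k : ℝ := φ x₀ - inner ℝ g x₀ + K * (R + ‖p - x₀‖) ^ 2
  set V : EuclideanSpace ℝ (Fin n) → ℝ := fun y => innerSL ℝ g y + k - H y
  have hVeq : ∀ y, V y = φ x₀ + inner ℝ g (y - x₀) + K * (R + ‖p - x₀‖) ^ 2 - H y := fun y => by
    simp only [V, k, innerSL_apply_apply, inner_sub_right]
    ring
  have hV : HarmonicOnNhd V univ := fun y hy =>
    ((harmonicAt_continuousLinearMap (innerSL ℝ g) y).add (harmonicAt_const k)).sub (hH y hy)
  have hVs : ∀ y ∈ sphere p R, 0 ≤ V y := fun y hy => by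
    have hy₀ : ‖y - x₀‖ ≤ R + ‖p - x₀‖ :=
      (norm_sub_le_norm_sub_add_norm_sub y p x₀).trans_eq (by rw [mem_sphere_iff_norm.mp hy])
    have hquad : K * ‖y - x₀‖ ^ 2 ≤ K * (R + ‖p - x₀‖) ^ 2 := by gcongr
    linarith [hVeq y, hHφ y hy, hg y (hsub hy)]
  have hVpos : ∀ y ∈ closedBall p R, 0 ≤ V y := le_of_harmonicOnNhd_of_le
    (fun y _ => (hV y (mem_univ y)).1.continuousAt.continuousWithinAt)
    (hV.mono (subset_univ _)) hVs
  have hharnack := harnack_inequality hV hR hVpos hx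
  rwa [hVeq, hVeq, finrank_euclideanSpace_fin] at hharnack

theorem le_subharmonicEnvelope_of_mem_contactSet [NeZero n]
    (hφL : LipschitzOnWith K φ (ball c 1)) (hφ : IsSemiconcaveOn (ball c 1) φ K)
    (hx₀ : x₀ ∈ contactSet (ball c 1) φ) (hx₀c : x₀ ∈ ball c (1 / 4))
    (hg : IsProximalSupergradient (ball c 1) φ K x₀ g) (hx : x ∈ ball x₀ (1 / 8)) (hne : x ≠ x₀) :
    (φ x₀ + inner ℝ g (x - x₀) -
        (3 * 4 ^ n * (12 * K + 2) + 4 * (K + 1)) * ‖x - x₀‖ ^ 2 : ℝ) ≤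
      subharmonicEnvelope (ball c 1) φ x := by
  set r : ℝ := ‖x - x₀‖
  have hr : 0 < r := norm_pos_iff.mpr (sub_ne_zero.mpr hne)
  have hr8 : r < 1 / 8 := mem_ball_iff_norm.mp hx
  have hrr : r ^ 2 ≤ r / 8 := by nlinarith
  obtain ⟨p, H, hp, hsub, hH, hHφ, hHp, hlow⟩ := exists_harmonic_of_mem_contactSet hφL hφ hx₀ hx₀c
    (δ := r ^ 2) (R := 2 * r) (by positivity) (by positivity) (by linarith)
  have hxp : ‖x - p‖ ≤ 9 / 16 * (2 * r) := by
    linarith [norm_sub_le_norm_sub_add_norm_sub x x₀ p, norm_sub_rev p x₀]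
  have hharnack := hg.sub_harmonic_le (by positivity) (sphere_subset_closedBall.trans hsub) hH hHφ
    hxp
  have hslope : inner ℝ g (p - x₀) ≤ 2 * K * r ^ 2 := by
    refine (hg.inner_le hφL hx₀.1 (mem_ball_iff_norm.mpr ?_)).trans ?_
    · linarith [norm_sub_le (x₀ - c) (p - x₀), mem_ball_iff_norm.mp hx₀c,
        congrArg norm (sub_right_comm x₀ (p - x₀) c)]
    · have hsq : ‖p - x₀‖ ^ 2 ≤ r ^ 2 := by nlinarith [norm_nonneg (p - x₀)]
      nlinarith [K.coe_nonneg]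
  have hquad : (2 * r + ‖p - x₀‖) ^ 2 ≤ (3 * r) ^ 2 := by
    gcongr
    linarith
  have hgap : φ x₀ + inner ℝ g (p - x₀) + K * (2 * r + ‖p - x₀‖) ^ 2 - H p ≤
      (12 * K + 2) * r ^ 2 := by
    linarith [mul_le_mul_of_nonneg_left hquad K.coe_nonneg]
  have hH_lower := hharnack.trans (mul_le_mul_of_nonneg_left hgap (by positivity))
  refine (EReal.coe_le_coe ?_).trans (hlow x (mem_ball_iff_norm.mpr (by linarith)))
  have hfrozen : 0 ≤ K * (2 * r + ‖p - x₀‖) ^ 2 := by positivity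
  have hbowl : 0 ≤ (K + 1) * ‖x - p‖ ^ 2 := by positivity
  linarith

end ContactPoint

open scoped NNReal in
theorem proposition4p5_general (n : ℕ) :
    ∃ C : ℝ≥0 → ℝ, ∀ (K : ℝ≥0) (c : EuclideanSpace ℝ (Fin n)) (φ : EuclideanSpace ℝ (Fin n) → ℝ),
      LipschitzOnWith K φ (ball c 1) → IsSemiconcaveOn (ball c 1) φ K →
      ∀ x₀ ∈ contactSet (ball c 1) φ ∩ ball c (1 / 4),
      ∀ g, IsProximalSupergradient (ball c 1) φ K x₀ g →
      ∀ x ∈ ball x₀ (1 / 8), ∃ t : ℝ, subharmonicEnvelope (ball c 1) φ x = t ∧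
        |t - φ x₀ - inner ℝ g (x - x₀)| ≤ C K * ‖x - x₀‖ ^ 2 := by
  refine ⟨fun K => 3 * 4 ^ n * (12 * K + 2) + 4 * (K + 1), ?_⟩
  rintro K c φ hφL hφ x₀ ⟨hx₀, hx₀c⟩ g hg x hx
  rcases eq_or_ne x x₀ with rfl | hne
  · exact ⟨φ x, hx₀.2, by simp⟩
  have : NeZero n := ⟨by rintro rfl; exact hne (Subsingleton.elim x x₀)⟩
  have hlow := le_subharmonicEnvelope_of_mem_contactSet hφL hφ hx₀ hx₀c hg hx hne
  have hxU : x ∈ ball c 1 := ball_subset_ball' (by linarith [mem_ball.mp hx₀c]) hx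
  have hup := subharmonicEnvelope_le (φ := φ) hxU
  lift subharmonicEnvelope (ball c 1) φ x to ℝ using
    ⟨(hup.trans_lt (EReal.coe_lt_top _)).ne, ((EReal.bot_lt_coe _).trans_le hlow).ne'⟩ with t
  rw [EReal.coe_le_coe_iff] at hlow hup
  refine ⟨t, rfl, abs_le.mpr ⟨by linarith, ?_⟩⟩
  have hC : K * ‖x - x₀‖ ^ 2 ≤
      (3 * 4 ^ n * (12 * K + 2) + 4 * (K + 1)) * ‖x - x₀‖ ^ 2 := by
    gcongr
    have : (0 : ℝ) ≤ 3 * 4 ^ n * (12 * K + 2) := by positivity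
    linarith [K.coe_nonneg]
  linarith [hg x hxU]

theorem proposition4p5 (n : ℕ) (hn : 1 ≤ n) :
    ∃ C : ℝ≥0∞ → ℝ≥0∞ → ℝ,
      ∀ (c : EuclideanSpace ℝ (Fin n)) (b : Fin 2 → EuclideanSpace ℝ (Fin n) → ℝ),
        (∀ j, MemC11 (ball c 1) (b j)) →
        ∀ x₀ ∈ contactSet (ball c 1) (fun z => min (b 0 z) (b 1 z)) ∩ ball c (1 / 4),
        ∀ i : Fin 2, min (b 0 x₀) (b 1 x₀) = b i x₀ →
        ∀ x ∈ ball x₀ (1 / 8), ∃ t : ℝ,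
          subharmonicEnvelope (ball c 1) (fun z => min (b 0 z) (b 1 z)) x = (t : EReal) ∧
          |t - b i x₀ - inner ℝ (∇ (b i) x₀) (x - x₀)| ≤
            C (c2Norm (ball c 1) (b 0)) (c2Norm (ball c 1) (b 1)) * ‖x - x₀‖ ^ 2 := by
  obtain ⟨C, hC⟩ := proposition4p5_general n
  refine ⟨fun s t => C (max s.toNNReal t.toNNReal), fun c b hb x₀ hx₀ i hi x hx => ?_⟩
  rw [← hi]
  exact hC _ c _ (lipschitzOnWith_min_of_memC11 hb isOpen_ball (convex_ball c 1))
    (isSemiconcaveOn_min_of_memC11 hb isOpen_ball (convex_ball c 1)) x₀ hx₀ _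
    (isProximalSupergradient_min_of_memC11 hb isOpen_ball (convex_ball c 1) hx₀.1.1 hi) x hx
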